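/- **Determinant expression of orthogonal Schur multiple zeta functions.** *Definitions.* A box is a pair $(i,j)\in\mathbb Z^2$ ($i$ = row, numbered downwards; $j$ = column); its content is $j-i$. Fix a positive integer $N$ and the ordered alphabet $1<\overline1<2<\overline2<\cdots<N<\overline N<\infty$, with $|k|=k$, $|\overline k|=k^{-1}$, $|\infty|=1$. A *so-tableau* on a finite set $D$ of boxes is a filling $M=(m_\alpha)_{\alpha\in D}$ by these letters such that: (1) rows are weakly increasing; (2) columns are strictly increasing downwards, except that the letter $\infty$ may be repeated in a column; (3) every entry in a box of content $-i$ is $\ge i+1$; (4) no two entries $\infty$ lie in the same row. For $\boldsymbol s=(s_\alpha)\in\mathbb C^{D}$ put $$\zeta^{\mathrm{so},N}_{D}(\boldsymbol s)=\sum_{M}\ \prod_{\alpha\in D}|m_\alpha|^{-s_\alpha},$$ the sum being over all so-tableaux $M$ on $D$ (so $\zeta^{\mathrm{so},N}_\emptyset=1$). A *strip* is a nonempty edgewise connected skew diagram without a $2\times2$ block; its starting box is its bottommost and leftmost box and its ending box its topmost and rightmost one. An *outside decomposition* of a skew diagram $\lambda/\mu$ is a tuple $(\theta_1,\dots,\theta_r)$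 of strips whose disjoint union is $\lambda/\mu$, such that each starting box lies on the left or bottom perimeter and each ending box on the right or top perimeter of $\lambda/\mu$. A box of $\theta_k$ is *approached from the left* (resp. *from below*) if the box to its left (resp. below it) belongs to $\theta_k$, or if it is the starting box of $\theta_k$ and lies on the left (resp. bottom) perimeter. An *approach rule* assigns to each $c\in\mathbb Z$ one of these two directions, in such a way that every box of content $c$ of $\lambda/\mu$ is approached from the direction assigned to $c$ (at contents that do not occur in $\lambda/\mu$ the choice is arbitrary). Given an approach rule, let $b_j$ be the content of the starting box of $\theta_j$ and $e_i$ that of the ending box of $\theta_i$. If $b_j\le e_i$, then $\theta_i\#\theta_j$ is the strip having one box of each content $b_j,b_j+1,\dots,e_i$, starting at the starting box of $\theta_j$, in which each box of content $c>b_j$ is placed to the right of the preceding box if $c$ is approached from the left, and above it if $c$ is approached from below. If $e_i=b_j-1$, then $\theta_i\#\theta_j=\emptyset$. If $e_i<b_j-1$, then $\theta_i\#\theta_j$ is undefined, and the corresponding matrix entry below is $0$. If $\boldsymbol s$ is constant on the diagonals of $\lambda/\mu$, then $\boldsymbol s_{\lambda_i}\#\boldsymbol s_{\lambda_j}$ is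 the filling of $\theta_i\#\theta_j$ whose entry in a box of content $c$ is the common value of $\boldsymbol s$ on the boxes of content $c$ (an arbitrary number, chosen once for each $c$, if $c$ does not occur in $\lambda/\mu$). **Theorem.** Let $\mu\subseteq\lambda$ be partitions, $N$ a positive integer, $\boldsymbol s=(s_{ij})\in\mathbb C^{\lambda/\mu}$ with $s_{ij}=s_{kl}$ whenever $j-i=l-k$, and $(\theta_1,\dots,\theta_r)$ any outside decomposition of $\lambda/\mu$. Then an approach rule exists, and for every approach rule and every choice of the values at the contents that do not occur in $\lambda/\mu$, $$\zeta^{\mathrm{so},N}_{\lambda/\mu}(\boldsymbol s)=\det\Bigl(\zeta^{\mathrm{so},N}_{\theta_i\#\theta_j}\bigl(\boldsymbol s_{\lambda_i}\#\boldsymbol s_{\lambda_j}\bigr)\Bigr)_{1\le i,j\le r}.$$ -/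

import Mathlib

noncomputable section

namespace SchurSo

open scoped Classical

/-- A box `(i, j)`: row `i` (rows are numbered downwards), column `j`. -/
abbrev Box : Type := ℤ × ℤ

/-- The content `j - i` of a box. -/
def content (α : Box) : ℤ := α.2 - α.1

/-- The diagram of `lam / mu`. Rows and columns of a `YoungDiagram` are numbered from `0`,
which changes neither contents nor relative positions. -/
def skewDiagram (lam mu : YoungDiagram) : Finset Box :=
  (lam.cells \ mu.cells).image (fun c : ℕ × ℕ => ((c.1 : ℤ), (c.2 : ℤ)))

/-! ### so-tableaux and orthogonal Schur multiple zeta functions -/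

/-- The ordered alphabet `1 < 1̄ < 2 < 2̄ < ⋯ < N < N̄ < ∞`: the pair `(k, false)` is the letter
`k + 1`, the pair `(k, true)` is its barred version, pairs are ordered lexicographically with
`false < true`, and `⊤` is `∞`. -/
abbrev Letter (N : ℕ) : Type := WithTop (Fin N ×ₗ Bool)

/-- `|k| = k`, `|k̄| = k⁻¹`, `|∞| = 1`. -/
def absLetter {N : ℕ} : Letter N → ℂ
  | none => 1
  | some p =>
      if (ofLex p).2 then (((ofLex p).1.val + 1 : ℕ) : ℂ)⁻¹ else (((ofLex p).1.val + 1 : ℕ) : ℂ)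

/-- The letter `x` is at least the (unbarred) integer letter `m`;
`∞` is larger than every integer. -/
def AtLeast {N : ℕ} (m : ℤ) : Letter N → Prop
  | none => True
  | some p => m ≤ (((ofLex p).1.val + 1 : ℕ) : ℤ)

/-- so-tableaux on a finite set `D` of boxes, with letters in `{1, 1̄, …, N, N̄, ∞}`. -/
structure IsSoTableau (N : ℕ) (D : Finset Box) (T : D → Letter N) : Prop where
  /-- Rows increase weakly from left to right. -/
  row_weak : ∀ α β : D, α.1.1 = β.1.1 → α.1.2 ≤ β.1.2 → T α ≤ T β
  /-- Columns increase strictly downwards, except that the dummy letter `∞` may be repeated. -/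
  col_strict : ∀ α β : D, α.1.2 = β.1.2 → α.1.1 < β.1.1 → T α < T β ∨ (T α = ⊤ ∧ T β = ⊤)
  /-- A box of content `-i` contains an entry that is at least `i + 1`. -/
  symplectic : ∀ (α : D) (i : ℤ), content α.1 = -i → AtLeast (i + 1) (T α)
  /-- No two entries `∞` lie in the same row. -/
  top_row : ∀ α β : D, α.1.1 = β.1.1 → T α = ⊤ → T β = ⊤ → α = β

/-- The orthogonal Schur multiple zeta function of a diagram `D`:
the sum over all so-tableaux `M` on `D` of `1 / ∏ |m_α| ^ s_α`. -/
def soZeta (N : ℕ) (D : Finset Box) (s : D → ℂ) : ℂ :=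
  ∑ T ∈ (Finset.univ : Finset (D → Letter N)).filter (IsSoTableau N D),
    1 / ∏ α : D, absLetter (T α) ^ s α

/-! ### Strips and outside decompositions -/

/-- Two boxes share an edge. -/
def EdgeAdj (α β : Box) : Prop :=
  (α.1 = β.1 ∧ (β.2 = α.2 + 1 ∨ α.2 = β.2 + 1)) ∨
    (α.2 = β.2 ∧ (β.1 = α.1 + 1 ∨ α.1 = β.1 + 1))

/-- A strip: a nonempty, edgewise connected skew diagram without a `2 × 2` block of boxes.
(The finite sets of boxes that are order-convex for the componentwise order are exactly the
translates of the skew diagrams.) -/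
structure IsStrip (θ : Finset Box) : Prop where
  nonempty : θ.Nonempty
  skew : (θ : Set Box).OrdConnected
  connected : ∀ α ∈ θ, ∀ β ∈ θ,
    Relation.ReflTransGen (fun x y => x ∈ θ ∧ y ∈ θ ∧ EdgeAdj x y) α β
  no_block : ∀ i j : ℤ,
    ¬ ((i, j) ∈ θ ∧ (i, j + 1) ∈ θ ∧ (i + 1, j) ∈ θ ∧ (i + 1, j + 1) ∈ θ)

/-- `α` is the starting box (bottommost and leftmost) of `θ`. -/
def IsStartBox (θ : Finset Box) (α : Box) : Prop :=
  α ∈ θ ∧ ∀ β ∈ θ, β.1 ≤ α.1 ∧ α.2 ≤ β.2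

/-- `α` is the ending box (topmost and rightmost) of `θ`. -/
def IsEndBox (θ : Finset Box) (α : Box) : Prop :=
  α ∈ θ ∧ ∀ β ∈ θ, α.1 ≤ β.1 ∧ β.2 ≤ α.2

/-- `α` lies on the left perimeter of `D`. -/
def OnLeft (D : Finset Box) (α : Box) : Prop := α ∈ D ∧ (α.1, α.2 - 1) ∉ D
/-- `α` lies on the bottom perimeter of `D`. -/
def OnBottom (D : Finset Box) (α : Box) : Prop := α ∈ D ∧ (α.1 + 1, α.2) ∉ D
/-- `α` lies on the right perimeter of `D`. -/
def OnRight (D : Finset Box) (α : Box) : Prop := α ∈ D ∧ (α.1, α.2 + 1) ∉ D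
/-- `α` lies on the top perimeter of `D`. -/
def OnTop (D : Finset Box) (α : Box) : Prop := α ∈ D ∧ (α.1 - 1, α.2) ∉ D

/-- `(θ 0, …, θ (r - 1))` is an outside decomposition of the diagram `D`. -/
structure IsOutsideDecomposition (D : Finset Box) {r : ℕ} (θ : Fin r → Finset Box) : Prop where
  strip : ∀ k, IsStrip (θ k)
  start_perimeter : ∀ k, ∃ α, IsStartBox (θ k) α ∧ (OnLeft D α ∨ OnBottom D α)
  end_perimeter : ∀ k, ∃ α, IsEndBox (θ k) α ∧ (OnRight D α ∨ OnTop D α)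
  disjoint : ∀ k l, k ≠ l → Disjoint (θ k) (θ l)
  union : ∀ α, α ∈ D ↔ ∃ k, α ∈ θ k

/-- The starting box of a strip (unique; arbitrary if there is none). -/
def startBox (θ : Finset Box) : Box := Classical.epsilon (IsStartBox θ)

/-- The ending box of a strip (unique; arbitrary if there is none). -/
def endBox (θ : Finset Box) : Box := Classical.epsilon (IsEndBox θ)

/-! ### The operation `#` -/

/-- The direction from which a strip arrives at a box. -/
inductive Direction
  | left
  | below

/-- In the strip `θ` of a decomposition of `D`, the box `α` is approached from the given direction:
the preceding box of the strip lies on that side of `α`, or `α` is the starting box of the strip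
and lies on the corresponding (left or bottom) perimeter of `D`. -/
def IsApproached (D θ : Finset Box) (α : Box) : Direction → Prop
  | .left => (α.1, α.2 - 1) ∈ θ ∨ (IsStartBox θ α ∧ OnLeft D α)
  | .below => (α.1 + 1, α.2) ∈ θ ∨ (IsStartBox θ α ∧ OnBottom D α)

/-- `dir` assigns to every content the direction from which all boxes of this content are
approached in the decomposition. It is unconstrained at contents that do not occur in the
diagram: there it is an arbitrary choice, made once for all boxes of that content. -/
def IsApproachRule (D : Finset Box) {r : ℕ} (θ : Fin r → Finset Box) (dir : ℤ → Direction) :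
    Prop :=
  ∀ k, ∀ α ∈ θ k, IsApproached D (θ k) α (dir (content α))

/-- The box that follows `α` (of content one more) if it is approached according to `dir`. -/
def nextBox (dir : ℤ → Direction) (α : Box) : Box :=
  match dir (content α + 1) with
  | .left => (α.1, α.2 + 1)
  | .below => (α.1 - 1, α.2)

/-- The strip `θ₁ # θ₂`: the boxes from the starting box of `θ₂` up to the content of the ending
box of `θ₁`, each approached as prescribed by `dir`. Where a content occurs in `θ₁` or in `θ₂`,
this is the superposition of `θ₂` and of `θ₁` slid along the diagonals; at contents
between the two strips it consists of the boxes inserted to bridge the gap. It is empty if the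
ending box of `θ₁` has content one less than the starting box of `θ₂`. -/
def hash (dir : ℤ → Direction) (θ₁ θ₂ : Finset Box) : Finset Box :=
  (Finset.range (content (endBox θ₁) + 1 - content (startBox θ₂)).toNat).image
    (fun n => (nextBox dir)^[n] (startBox θ₂))

/-- `θ₁ # θ₂` is defined, unless the ending box of `θ₁` precedes the starting box of `θ₂` by at
least two contents. -/
def HashDefined (θ₁ θ₂ : Finset Box) : Prop :=
  content (startBox θ₂) ≤ content (endBox θ₁) + 1

/-- A filling that is constant on the diagonals. -/
def IsDiagConst (D : Finset Box) (s : D → ℂ) : Prop :=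
  ∀ α β : D, content α.1 = content β.1 → s α = s β

/-- The common value of the diagonally constant filling `s` on the boxes of content `c`;
at contents that do not occur in `D` it is the value `fill c`. -/
def diagEntry (D : Finset Box) (s : D → ℂ) (fill : ℤ → ℂ) (c : ℤ) : ℂ :=
  if h : ∃ α : D, content α.1 = c then s h.choose else fill c

/-- The entry `ζ^{so,N}_{θ₁ # θ₂}` of the determinant at the filling of `θ₁ # θ₂` by the diagonal
values of `s`; it is `0` if `θ₁ # θ₂` is undefined
(and it is `1`, the value at the empty diagram, if `θ₁ # θ₂` is empty). -/
def hashZeta (N : ℕ) (D : Finset Box) (s : D → ℂ) (fill : ℤ → ℂ) (dir : ℤ → Direction)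
    (θ₁ θ₂ : Finset Box) : ℂ :=
  if HashDefined θ₁ θ₂ then
    soZeta N (hash dir θ₁ θ₂) (fun β => diagEntry D s fill (content β.1))
  else 0

end SchurSo

end

/-! The proof sweeps the diagram diagonal by diagonal. Let x stand in a box and y in its right or
upper neighbour. The row condition `RowRel x y` and the column condition (y above x) are exact
complements. Hence an approach rule only decides, at each content, which of the two is called
`StepRel`; the other is its negation. The lower bound on entries depends only on content and letter,
so it goes into a weight.

Fix a filling of the boxes of content at least c. To it belongs the matrix whose row i is a unit
vector if strip i starts after c, and consists of the sums `total` over complete strips if strip i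
has ended before c. Otherwise its j-th entry is the sum `reach` over directed strips that begin
where strip j begins and arrive at content c with the letter of strip i there. `partialSum` adds up
these determinants times the weights of the letters of content larger than c. Below all contents the
matrix is the identity and the sum is the zeta function; above all contents no letters remain and
the matrix is the one of the theorem. So it is enough that `partialSum` does not depend on c
(`partialSum_succ`).

To pass from c + 1 to c, fix the letters beyond c and sum over the diagonal c. By multilinearity
this sums each row over the letters allowed in its box. These form a difference of two nested sets
(`StepRel.of_otherBox`), one for each neighbour on the next diagonal, so each summed row is a
difference of two rows of the old matrix (`sum_allowed`). Such row operations are unitriangular, and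
a strip starting at c + 1 only contributes a unit column (`det_sum_allowed`).

The same formula for a decomposition into one strip identifies the entries with zeta functions of
strips. The geometric remainder shows that an outside decomposition consists of strips directed by a
common rule. -/

noncomputable section

namespace SchurSo

open scoped Classical

/-! ### Two determinant lemmas. -/

/-- Subtracting from each row at most one row of higher rank preserves the determinant. -/
theorem det_eq_of_sub_higher_row {R ι : Type*} [CommRing R] [Fintype ι] [DecidableEq ι]
    (A B : Matrix ι ι R)
    (next : ι → Option ι) (f : ι → ℤ) (hf : ∀ i k, next i = some k → f i < f k)
    (hB : ∀ i j, B i j = A i j - (next i).elim 0 (fun k => A k j)) : B.det = A.det := by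
  set P : Matrix ι ι R := Matrix.of fun i k => if next i = some k then 1 else 0 with hP
  have hmul : B = (1 - P) * A := by
    ext i j
    rw [sub_mul, one_mul, Matrix.sub_apply, hB, Matrix.mul_apply]
    congr 1
    cases h : next i with
    | none => simp [hP, h]
    | some k => simp [hP, h]
  have htri : (1 - P).BlockTriangular f := by
    intro i j hij
    have hne : i ≠ j := by rintro rfl; exact lt_irrefl _ hij
    have : next i ≠ some j := fun h => lt_asymm hij (hf i j h)
    simp [hP, hne, this]
  -- `f` need not be injective, hence block triangularity; since `next` strictly raises `f`, the
  -- diagonal blocks are identity matrices.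
  have hdet : (1 - P).det = 1 := by
    rw [htri.det]
    refine Finset.prod_eq_one fun a _ => ?_
    have : (1 - P).toSquareBlock f a = 1 := by
      ext ⟨i, hi⟩ ⟨j, hj⟩
      have : next i ≠ some j := fun h => absurd (hf i j h) (by rw [hi, hj]; exact lt_irrefl _)
      simp [Matrix.toSquareBlock_def, hP, this, Matrix.one_apply]
    rw [this, Matrix.det_one]
  rw [hmul, Matrix.det_mul, hdet, one_mul]

/-- If the column `k` of `A` is a unit vector, then the determinant does not depend on the
remaining entries of the row `k`. -/
theorem det_eq_of_unit_column {R ι : Type*} [CommRing R] [Fintype ι] [DecidableEq ι]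
    (A B : Matrix ι ι R)
    (k : ι) (hA : ∀ i, i ≠ k → A i k = 0) (hAB : ∀ i, i ≠ k → B i = A i)
    (hk : B k k = A k k) : B.det = A.det := by
  have hB : B = A.updateRow k (A k + (B k - A k)) := by
    ext i j
    by_cases h : i = k
    · subst h; simp
    · simp [Matrix.updateRow_ne h, hAB i h]
  rw [hB, Matrix.det_updateRow_add, Matrix.updateRow_eq_self, add_eq_left]
  -- The remaining matrix has the row `B k - A k`, which vanishes in column `k` by `hk`; the other
  -- entries of that column vanish by `hA`.
  refine Matrix.det_eq_zero_of_column_eq_zero k fun i => ?_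
  by_cases h : i = k
  · subst h; simp [hk]
  · rw [Matrix.updateRow_ne h, hA i h]

/-! ### Row and column relations between letters. -/

/-- The letter `x` may stand directly to the left of the letter `y`. -/
def RowRel {N : ℕ} (x y : Letter N) : Prop := x ≤ y ∧ ¬ (x = ⊤ ∧ y = ⊤)

theorem RowRel.trans {N : ℕ} {x y z : Letter N} (h : RowRel x y) (h' : RowRel y z) :
    RowRel x z := by
  refine ⟨h.1.trans h'.1, fun ⟨hx, _⟩ => h.2 ⟨hx, ?_⟩⟩
  exact top_le_iff.1 (hx ▸ h.1)

/-- The right-hand side is the column condition for `y` above `x`. The complementarity includes ∞,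
which may repeat in a column but not in a row. -/
theorem not_rowRel_iff {N : ℕ} {x y : Letter N} :
    ¬ RowRel x y ↔ y < x ∨ (y = ⊤ ∧ x = ⊤) := by
  unfold RowRel
  by_cases h : x ≤ y
  · have := not_lt.2 h
    tauto
  · have := not_le.1 h
    tauto

theorem not_rowRel_trans {N : ℕ} {x y z : Letter N} (h : ¬ RowRel x y) (h' : ¬ RowRel y z) :
    ¬ RowRel x z := by
  rw [not_rowRel_iff] at *
  rcases h with h | ⟨h1, h2⟩ <;> rcases h' with h' | ⟨h3, h4⟩
  · exact Or.inl (h'.trans h)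
  · exact absurd h (by simp [h4])
  · exact Or.inl (by rw [h2, ← h1]; exact h')
  · exact Or.inr ⟨h3, h2⟩

/-- In a 2 × 2 square with `z` in the upper right, `a` to its left and `b` below it, the conditions
at `z` force `a < b`; `y` is the lower left letter. -/
theorem RowRel.of_diagonal {N : ℕ} {a b z y : Letter N} (ha : RowRel a z) (hb : ¬ RowRel b z)
    (hy : RowRel y a) : RowRel y b := by
  have hab : a < b := by
    by_contra hba
    rw [not_lt] at hba
    refine hb ⟨hba.trans ha.1, fun ⟨h1, h2⟩ => ha.2 ⟨?_, h2⟩⟩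
    exact top_le_iff.1 (h1 ▸ hba)
  refine ⟨hy.1.trans hab.le, fun ⟨h1, _⟩ => ?_⟩
  exact absurd (hy.1.trans_lt hab) (by simp [h1])

/-! ### Directed steps and neighbouring diagonals of a skew diagram. -/

/-- A box of content `c` containing the letter `y` may follow, in a strip directed by `dir`,
a box containing the letter `x`. -/
def StepRel {N : ℕ} (dir : ℤ → Direction) (c : ℤ) (x y : Letter N) : Prop :=
  match dir c with
  | .left => RowRel x y
  | .below => ¬ RowRel x y

/-- Of the right and the upper neighbour of `α`, the one which is not `nextBox dir α`. -/
def otherBox (dir : ℤ → Direction) (α : Box) : Box :=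
  match dir (content α + 1) with
  | .left => (α.1 - 1, α.2)
  | .below => (α.1, α.2 + 1)

/-- The box preceding `α` if `α` is approached according to `dir`. -/
def prevBox (dir : ℤ → Direction) (α : Box) : Box :=
  match dir (content α) with
  | .left => (α.1, α.2 - 1)
  | .below => (α.1 + 1, α.2)

theorem content_nextBox (dir : ℤ → Direction) (α : Box) :
    content (nextBox dir α) = content α + 1 := by
  unfold nextBox
  cases dir (content α + 1) <;> simp [content] <;> ring

theorem content_otherBox (dir : ℤ → Direction) (α : Box) :
    content (otherBox dir α) = content α + 1 := by
  unfold otherBox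
  cases dir (content α + 1) <;> simp [content] <;> ring

theorem content_prevBox (dir : ℤ → Direction) (α : Box) :
    content (prevBox dir α) = content α - 1 := by
  unfold prevBox
  cases dir (content α) <;> simp [content] <;> ring

theorem nextBox_prevBox (dir : ℤ → Direction) (α : Box) :
    nextBox dir (prevBox dir α) = α := by
  unfold nextBox
  rw [content_prevBox, sub_add_cancel]
  unfold prevBox
  cases dir (content α) <;> simp

theorem prevBox_nextBox (dir : ℤ → Direction) (α : Box) :
    prevBox dir (nextBox dir α) = α := by
  unfold prevBox
  rw [content_nextBox]
  unfold nextBox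
  cases dir (content α + 1) <;> simp

theorem mem_of_between {D : Finset Box} (hD : (D : Set Box).OrdConnected) {α β γ : Box}
    (hα : α ∈ D) (hγ : γ ∈ D) (h1 : α.1 ≤ β.1) (h2 : α.2 ≤ β.2) (h3 : β.1 ≤ γ.1)
    (h4 : β.2 ≤ γ.2) : β ∈ D := by
  have h : β ∈ Set.Icc α γ := ⟨Prod.mk_le_mk.2 ⟨h1, h2⟩, Prod.mk_le_mk.2 ⟨h3, h4⟩⟩
  exact Finset.mem_coe.1 (hD.out (Finset.mem_coe.2 hα) (Finset.mem_coe.2 hγ) h)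

/-- Two boxes of the same content in a skew diagram that both have no predecessor coincide. -/
theorem eq_of_prevBox_notMem {D : Finset Box} (hD : (D : Set Box).OrdConnected)
    {dir : ℤ → Direction} {α β : Box} (hα : α ∈ D) (hβ : β ∈ D) (hc : content α = content β)
    (hpα : prevBox dir α ∉ D) (hpβ : prevBox dir β ∉ D) : α = β := by
  wlog hle : α.1 ≤ β.1 generalizing α β
  · exact (this hβ hα hc.symm hpβ hpα (by omega)).symm
  by_contra hne
  have hlt : α.1 < β.1 := by
    refine lt_of_le_of_ne hle fun h => hne ?_
    unfold content at hc
    exact Prod.ext h (by omega)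
  unfold prevBox at hpα hpβ
  rw [← hc] at hpβ
  unfold content at hc
  cases h : dir (content α) <;> rw [h] at hpα hpβ
  · exact hpβ (mem_of_between hD hα hβ (by simp; omega) (by simp; omega) (by simp) (by simp))
  · exact hpα (mem_of_between hD hα hβ (by simp) (by simp) (by simp; omega) (by simp; omega))

/-- If a box of content `c + 1` has no predecessor in a skew diagram, then for all boxes of
content `c` the second neighbour of content `c + 1` belongs to the diagram. -/
theorem otherBox_mem_of_prevBox_notMem {D : Finset Box} (hD : (D : Set Box).OrdConnected)
    {dir : ℤ → Direction} {α β : Box} (hα : α ∈ D) (hβ : β ∈ D)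
    (hc : content β = content α + 1) (hpβ : prevBox dir β ∉ D) : otherBox dir α ∈ D := by
  unfold prevBox at hpβ
  unfold otherBox
  rw [hc] at hpβ
  unfold content at hc
  cases h : dir (content α + 1) <;> rw [h] at hpβ
  · rcases le_or_gt α.1 β.1 with hle | hlt
    · exact absurd (mem_of_between hD hα hβ (by simp; omega) (by simp; omega) (by simp)
        (by simp)) hpβ
    · exact mem_of_between hD hβ hα (by simp; omega) (by simp; omega) (by simp) (by simp)
  · rcases le_or_gt α.1 β.1 with hle | hlt
    · exact mem_of_between hD hα hβ (by simp) (by simp) (by simp; omega) (by simp; omega)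
    · exact absurd (mem_of_between hD hβ hα (by simp) (by simp) (by simp; omega)
        (by simp; omega)) hpβ

/-- The adjacency conditions of a tableau, for the pairs of boxes of content at least `c`. -/
def ValidFrom {N : ℕ} (D : Finset Box) (c : ℤ) (T : D → Letter N) : Prop :=
  ∀ α β : D, c ≤ content α.1 →
    (β.1 = (α.1.1, α.1.2 + 1) → RowRel (T α) (T β)) ∧
    (β.1 = (α.1.1 - 1, α.1.2) → ¬ RowRel (T α) (T β))

theorem validFrom_iff {N : ℕ} {D : Finset Box} {c : ℤ} {T : D → Letter N}
    (dir : ℤ → Direction) :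
    ValidFrom D c T ↔ ∀ α β : D, c ≤ content α.1 →
      (β.1 = nextBox dir α.1 → StepRel dir (content α.1 + 1) (T α) (T β)) ∧
      (β.1 = otherBox dir α.1 → ¬ StepRel dir (content α.1 + 1) (T α) (T β)) := by
  unfold ValidFrom nextBox otherBox StepRel
  refine forall_congr' fun α => forall_congr' fun β => imp_congr_right fun _ => ?_
  cases dir (content α.1 + 1)
  · rfl
  · simp only [not_not]
    exact and_comm

/-- On the diagonal following that of `α`, the two neighbours of `α` carry letters such that
every letter which may precede the second one may precede the first one. -/
theorem StepRel.of_otherBox {N : ℕ} {D : Finset Box} (hD : (D : Set Box).OrdConnected)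
    {dir : ℤ → Direction} {T : D → Letter N} {α : Box} (hT : ValidFrom D (content α + 1) T)
    {β γ : D} (hβ : β.1 = nextBox dir α) (hγ : γ.1 = otherBox dir α) {y : Letter N}
    (h : StepRel dir (content α + 1) y (T γ)) : StepRel dir (content α + 1) y (T β) := by
  have cβ : content β.1 = content α + 1 := by rw [hβ, content_nextBox]
  have cγ : content γ.1 = content α + 1 := by rw [hγ, content_otherBox]
  unfold StepRel at *
  unfold nextBox at hβ
  unfold otherBox at hγ
  cases hd : dir (content α + 1) <;> rw [hd] at hβ hγ h <;> simp only at h hβ hγ ⊢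
  -- The fourth box of the 2 × 2 square lies in `D` by convexity, and its letter compares those of
  -- the two neighbours of `α`.
  · have hm : (α.1 - 1, α.2 + 1) ∈ D := mem_of_between hD γ.2 β.2 (by simp [hγ])
      (by simp [hγ]) (by simp [hβ]) (by simp [hβ])
    refine RowRel.of_diagonal (z := T ⟨_, hm⟩) ((hT γ ⟨_, hm⟩ (by omega)).1 ?_)
      ((hT β ⟨_, hm⟩ (by omega)).2 ?_) h
    · simp [hγ]
    · simp [hβ]
  · have hm : (α.1 - 1, α.2 + 1) ∈ D := mem_of_between hD β.2 γ.2 (by simp [hβ])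
      (by simp [hβ]) (by simp [hγ]) (by simp [hγ])
    refine fun h' => h (RowRel.of_diagonal (z := T ⟨_, hm⟩) ((hT β ⟨_, hm⟩ (by omega)).1 ?_)
      ((hT γ ⟨_, hm⟩ (by omega)).2 ?_) h')
    · simp [hβ]
    · simp [hγ]

/-! ### Sums over the fillings of a single directed strip. -/

/-- The sum over all fillings of the strip directed by `dir` with contents `b, …, b + n` whose
last letter is `y`. -/
def stripSum {N : ℕ} (w : ℤ → Letter N → ℂ) (dir : ℤ → Direction) (b : ℤ) :
    ℕ → Letter N → ℂ
  | 0, y => w b y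
  | n + 1, y => w (b + n + 1) y *
      ∑ x, if StepRel dir (b + n + 1) x y then stripSum w dir b n x else 0

/-- The sum over all fillings of the strip directed by `dir` with contents `b, …, c` whose
last letter is `y`; it is `0` if `c < b`. -/
def reach {N : ℕ} (w : ℤ → Letter N → ℂ) (dir : ℤ → Direction) (b c : ℤ) (y : Letter N) : ℂ :=
  if b ≤ c then stripSum w dir b (c - b).toNat y else 0

/-- The sum over all fillings of the strip directed by `dir` with contents `b, …, e`; it is `1` if
`b = e + 1`, and `0` if `b > e + 1`. -/
def total {N : ℕ} (w : ℤ → Letter N → ℂ) (dir : ℤ → Direction) (b e : ℤ) : ℂ :=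
  (if b = e + 1 then 1 else 0) + ∑ x, reach w dir b e x

theorem reach_of_lt {N : ℕ} (w : ℤ → Letter N → ℂ) (dir : ℤ → Direction) {b c : ℤ} (h : c < b)
    (y : Letter N) : reach w dir b c y = 0 := by
  simp [reach, h]

theorem total_of_lt {N : ℕ} (w : ℤ → Letter N → ℂ) (dir : ℤ → Direction) {b e : ℤ}
    (h : e + 1 < b) : total w dir b e = 0 := by
  have : b ≠ e + 1 := by omega
  simp [total, this, reach_of_lt w dir (show e < b by omega)]

theorem total_self {N : ℕ} (w : ℤ → Letter N → ℂ) (dir : ℤ → Direction) {b e : ℤ}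
    (h : b = e + 1) : total w dir b e = 1 := by
  simp [total, h, reach_of_lt w dir (show e < e + 1 by omega)]

/-- The summand 1 is the empty strip awaiting its first box; with it, the birth of a strip and its
extension obey one recursion. -/
theorem reach_succ {N : ℕ} (w : ℤ → Letter N → ℂ) (dir : ℤ → Direction) (b c : ℤ)
    (y : Letter N) :
    reach w dir b (c + 1) y = w (c + 1) y *
      ((if b = c + 1 then 1 else 0) +
        ∑ x, if StepRel dir (c + 1) x y then reach w dir b c x else 0) := by
  rcases lt_trichotomy b (c + 1) with h | h | h
  · obtain ⟨n, rfl⟩ : ∃ n : ℕ, c = b + n := ⟨(c - b).toNat, by omega⟩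
    have h1 : (b + (n : ℤ) + 1 - b).toNat = n + 1 := by omega
    have h2 : (b + (n : ℤ) - b).toNat = n := by omega
    simp only [reach, h1, h2, h.ne, if_true, if_false, zero_add, h.le,
      show b ≤ b + (n : ℤ) by omega, stripSum]
  · subst h
    simp [reach, stripSum]
  · have h' : c < b := by omega
    simp [reach_of_lt w dir h, reach_of_lt w dir h', h.ne']

/-! ### Strip labellings and the determinant identity across one diagonal. -/

/-- A partition of `D` into strips directed by `dir`: the `i`-th strip has one box
`box i c` of each content `c` with `b i ≤ c ≤ e i`. -/
structure StripLabelling (D : Finset Box) (dir : ℤ → Direction) {r : ℕ} (b e : Fin r → ℤ) where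
  box : Fin r → ℤ → Box
  lab : D → Fin r
  le : ∀ i, b i ≤ e i
  content_box : ∀ i c, b i ≤ c → content (box i c) = c
  box_succ : ∀ i c, b i ≤ c → box i (c + 1) = nextBox dir (box i c)
  box_mem : ∀ i c, b i ≤ c → c ≤ e i → box i c ∈ D
  lab_box : ∀ i c, b i ≤ c → c ≤ e i → ∀ h : box i c ∈ D, lab ⟨box i c, h⟩ = i
  start_le : ∀ α : D, b (lab α) ≤ content α.1
  le_end : ∀ α : D, content α.1 ≤ e (lab α)
  box_lab : ∀ α : D, box (lab α) (content α.1) = α.1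
  lt_end : ∀ i c, b i ≤ c → c ≤ e i → nextBox dir (box i c) ∈ D → c < e i

namespace StripLabelling

variable {D : Finset Box} {dir : ℤ → Direction} {r : ℕ} {b e : Fin r → ℤ}

/-- A strip containing this predecessor could not end there, by `lt_end`, so it would run into the
starting box and be strip `i` itself, which begins only one content later. -/
theorem prevBox_start_notMem (S : StripLabelling D dir b e) (i : Fin r) :
    prevBox dir (S.box i (b i)) ∉ D := by
  intro h
  set k := S.lab ⟨_, h⟩ with hk
  have hc : content (prevBox dir (S.box i (b i))) = b i - 1 := by
    rw [content_prevBox, S.content_box i _ le_rfl]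
  have h1 : b k ≤ b i - 1 := by rw [← hc]; exact S.start_le ⟨_, h⟩
  have h2 : b i - 1 ≤ e k := by rw [← hc]; exact S.le_end ⟨_, h⟩
  have h3 : S.box k (b i - 1) = prevBox dir (S.box i (b i)) := by
    rw [← hc]; exact S.box_lab ⟨_, h⟩
  have hmem := S.box_mem i _ le_rfl (S.le i)
  have h4 : nextBox dir (S.box k (b i - 1)) = S.box i (b i) := by rw [h3, nextBox_prevBox]
  have h5 := S.lt_end k _ h1 h2 (by rw [h4]; exact hmem)
  have h6 : S.box k (b i) = S.box i (b i) := by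
    rw [← h4, ← S.box_succ k _ h1, sub_add_cancel]
  have h7 := S.lab_box k (b i) (by omega) (by omega) (by rw [h6]; exact hmem)
  have h8 := S.lab_box i (b i) le_rfl (S.le i) hmem
  simp only [h6] at h7
  rw [h7] at h8
  rw [h8] at h1
  omega

/-- At most one strip is born at each content, so crossing a diagonal produces at most one
exceptional row. -/
theorem eq_of_start_eq (hD : (D : Set Box).OrdConnected) (S : StripLabelling D dir b e)
    {i k : Fin r} (h : b i = b k) : i = k := by
  have hi := S.box_mem i _ le_rfl (S.le i)
  have hk := S.box_mem k _ le_rfl (S.le k)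
  have heq : S.box i (b i) = S.box k (b k) := by
    refine eq_of_prevBox_notMem hD (dir := dir) hi hk ?_ (S.prevBox_start_notMem i)
      (S.prevBox_start_notMem k)
    rw [S.content_box i _ le_rfl, S.content_box k _ le_rfl, h]
  have h1 := S.lab_box i _ le_rfl (S.le i) hi
  have h2 := S.lab_box k _ le_rfl (S.le k) hk
  simp only [heq] at h1
  rw [← h1, h2]

/-- When a strip is born at `c + 1`, every strip present at `c` has a neighbour there, whose row
supplies the constant 1 to be cancelled. -/
theorem otherBox_mem_of_start (hD : (D : Set Box).OrdConnected) (S : StripLabelling D dir b e)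
    {i k : Fin r} {c : ℤ} (hi : b i ≤ c) (hi' : c ≤ e i) (hk : b k = c + 1) :
    otherBox dir (S.box i c) ∈ D := by
  refine otherBox_mem_of_prevBox_notMem hD (S.box_mem i c hi hi')
    (S.box_mem k _ le_rfl (S.le k)) ?_ (S.prevBox_start_notMem k)
  rw [S.content_box i _ hi, S.content_box k _ le_rfl, hk]

variable {N : ℕ} (w : ℤ → Letter N → ℂ)

/-- The letters which may be put into the box of content `c` of the `i`-th strip, when the
boxes of larger content are filled according to `T`. -/
def allowed (S : StripLabelling D dir b e) (c : ℤ) (T : D → Letter N) (i : Fin r) :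
    Finset (Letter N) :=
  if b i ≤ c ∧ c ≤ e i then
    Finset.univ.filter fun y =>
      (∀ β : D, β.1 = nextBox dir (S.box i c) → StepRel dir (c + 1) y (T β)) ∧
      (∀ β : D, β.1 = otherBox dir (S.box i c) → ¬ StepRel dir (c + 1) y (T β))
  else {⊤}

/-- The letters of a filling on the diagonal of content `c`, indexed by the strips. -/
def layer (S : StripLabelling D dir b e) (c : ℤ) (T : D → Letter N) (i : Fin r) : Letter N :=
  if h : b i ≤ c ∧ c ≤ e i then T ⟨S.box i c, S.box_mem i c h.1 h.2⟩ else ⊤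

/-- The entries of the row of index `i` when the box of content `c` of the `i`-th strip carries
the letter `y`. -/
def entry (dir : ℤ → Direction) (b e : Fin r → ℤ) (c : ℤ) (i : Fin r) (y : Letter N)
    (j : Fin r) : ℂ :=
  if c < b i then (if i = j then 1 else 0)
  else if e i < c then total w dir (b j) (e i)
  else reach w dir (b j) c y

/-- The entries `entry` at the content `c + 1` without the last weight. -/
def preEntry (dir : ℤ → Direction) (b e : Fin r → ℤ) (c : ℤ) (i : Fin r) (y : Letter N)
    (j : Fin r) : ℂ :=
  if c + 1 < b i then (if i = j then 1 else 0)
  else if e i < c + 1 then total w dir (b j) (e i)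
  else (if b j = c + 1 then 1 else 0) +
    ∑ x, if StepRel dir (c + 1) x y then reach w dir (b j) c x else 0

theorem entry_succ (dir : ℤ → Direction) (b e : Fin r → ℤ) (c : ℤ) (i : Fin r) (y : Letter N)
    (j : Fin r) : entry w dir b e (c + 1) i y j =
      (if b i ≤ c + 1 ∧ c + 1 ≤ e i then w (c + 1) y else 1) * preEntry w dir b e c i y j := by
  unfold entry preEntry
  rcases lt_or_ge (c + 1) (b i) with h1 | h1
  · simp [h1, not_le.2 h1]
  · rcases lt_or_ge (e i) (c + 1) with h2 | h2
    · simp [not_lt.2 h1, h2, not_le.2 h2]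
    · rw [if_neg (not_lt.2 h1), if_neg (not_lt.2 h2), if_neg (not_lt.2 h1),
        if_neg (not_lt.2 h2), if_pos ⟨h1, h2⟩, reach_succ]

/-- The strip, if any, containing the second neighbour of the box of content `c` of the `i`-th
strip. -/
def neighbour (S : StripLabelling D dir b e) (c : ℤ) (i : Fin r) : Option (Fin r) :=
  if h : (b i ≤ c ∧ c ≤ e i) ∧ otherBox dir (S.box i c) ∈ D then
    some (S.lab ⟨otherBox dir (S.box i c), h.2⟩)
  else none

/-- A position on the diagonal of content `c + 1`, increasing from a strip to its neighbour. -/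
def rank (S : StripLabelling D dir b e) (c : ℤ) (i : Fin r) : ℤ :=
  match dir (c + 1) with
  | .left => -(S.box i (c + 1)).1
  | .below => (S.box i (c + 1)).1

theorem box_neighbour (S : StripLabelling D dir b e) {c : ℤ} {i : Fin r}
    (hi : b i ≤ c) (h : otherBox dir (S.box i c) ∈ D) :
    S.box (S.lab ⟨_, h⟩) (c + 1) = otherBox dir (S.box i c) ∧
      b (S.lab ⟨_, h⟩) ≤ c + 1 ∧ c + 1 ≤ e (S.lab ⟨_, h⟩) := by
  have hc : content (otherBox dir (S.box i c)) = c + 1 := by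
    rw [content_otherBox, S.content_box i c hi]
  refine ⟨?_, ?_, ?_⟩
  · conv_lhs => rw [← hc]
    exact S.box_lab ⟨_, h⟩
  · conv_rhs => rw [← hc]
    exact S.start_le ⟨_, h⟩
  · conv_lhs => rw [← hc]
    exact S.le_end ⟨_, h⟩

/-- `nextBox` and `otherBox` are consecutive places on the next diagonal, always in the order fixed
by `dir (c + 1)`. As `box` continues beyond the end of a strip, the rank also makes sense for a
strip ending at `c`. -/
theorem rank_lt_rank (S : StripLabelling D dir b e) (c : ℤ) (i k : Fin r)
    (h : S.neighbour c i = some k) : S.rank c i < S.rank c k := by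
  unfold neighbour at h
  split_ifs at h with hh
  obtain ⟨⟨h1, _⟩, h3⟩ := hh
  have hk := (S.box_neighbour h1 h3).1
  rw [Option.some.inj h] at hk
  have hc := S.content_box i c h1
  unfold rank
  rw [hk, S.box_succ i c h1]
  unfold otherBox nextBox
  rw [hc]
  cases dir (c + 1) <;> simp

theorem layer_of_mem (S : StripLabelling D dir b e) (T : D → Letter N) (β : D) :
    S.layer (content β.1) T (S.lab β) = T β := by
  have h : b (S.lab β) ≤ content β.1 ∧ content β.1 ≤ e (S.lab β) := ⟨S.start_le β, S.le_end β⟩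
  unfold layer
  rw [dif_pos h]
  congr 1
  exact Subtype.ext (S.box_lab β)

theorem layer_box (S : StripLabelling D dir b e) (T : D → Letter N) {i : Fin r} {c : ℤ}
    (h1 : b i ≤ c) (h2 : c ≤ e i) {β : D} (hβ : β.1 = S.box i c) : S.layer c T i = T β := by
  unfold layer
  rw [dif_pos ⟨h1, h2⟩]
  congr 1
  exact Subtype.ext hβ.symm

/-- By `StepRel.of_otherBox`, the letters compatible with the second neighbour are among those
compatible with the next box. The sum over the set difference is a difference of sums, in which the
birth constants cancel. -/
theorem sum_allowed (hD : (D : Set Box).OrdConnected) (S : StripLabelling D dir b e) {c : ℤ}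
    {T : D → Letter N} (hT : ValidFrom D (c + 1) T) {i : Fin r} (hi : b i ≤ c) (hi' : c ≤ e i)
    (j : Fin r) :
    ∑ y ∈ S.allowed c T i, reach w dir (b j) c y =
      preEntry w dir b e c i (S.layer (c + 1) T i) j -
        (S.neighbour c i).elim (if b j = c + 1 then 1 else 0)
          (fun k => preEntry w dir b e c k (S.layer (c + 1) T k) j) := by
  have hcb := S.content_box i c hi
  have hown : preEntry w dir b e c i (S.layer (c + 1) T i) j = (if b j = c + 1 then 1 else 0) +
      ∑ x, if ∀ β : D, β.1 = nextBox dir (S.box i c) → StepRel dir (c + 1) x (T β) then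
        reach w dir (b j) c x else 0 := by
    unfold preEntry
    rw [if_neg (by omega)]
    split_ifs with h1 h2 h2
    -- If strip `i` ends at `c`, its row is already closed to `total`. This agrees with the
    -- unrestricted sum, because `lt_end` keeps the next box out of `D`.
    · have he : e i = c := by omega
      simp only [total, he, h2, if_true]
      congr 1
      refine Finset.sum_congr rfl fun x _ => (if_pos fun β hβ => ?_).symm
      have := S.lt_end i c hi hi' (hβ ▸ β.2)
      omega
    · have he : e i = c := by omega
      simp only [total, he, h2, if_false]
      congr 1
      refine Finset.sum_congr rfl fun x _ => (if_pos fun β hβ => ?_).symm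
      have := S.lt_end i c hi hi' (hβ ▸ β.2)
      omega
    all_goals
      congr 1
      refine Finset.sum_congr rfl fun x _ => ?_
      congr 1
      have hm := S.box_mem i (c + 1) (by omega) (by omega)
      rw [S.layer_box T (β := ⟨_, hm⟩) (by omega) (by omega) rfl, ← S.box_succ i c hi]
      refine propext ⟨fun h β hβ => ?_, fun h => h _ rfl⟩
      have : β = ⟨_, hm⟩ := Subtype.ext hβ
      rw [this]; exact h
  have hoth : (S.neighbour c i).elim (if b j = c + 1 then 1 else 0)
      (fun k => preEntry w dir b e c k (S.layer (c + 1) T k) j) =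
      (if b j = c + 1 then 1 else 0) +
      ∑ x, if ∃ β : D, β.1 = otherBox dir (S.box i c) ∧ StepRel dir (c + 1) x (T β) then
        reach w dir (b j) c x else 0 := by
    unfold neighbour
    split_ifs with h1 h2 h2
    pick_goal 3
    · simp only [Option.elim]
      rw [Finset.sum_eq_zero, add_zero]
      rintro x -
      refine if_neg fun ⟨β, hβ, _⟩ => h1 ⟨⟨hi, hi'⟩, hβ ▸ β.2⟩
    pick_goal 3
    · simp only [Option.elim]
      rw [Finset.sum_eq_zero, add_zero]
      rintro x -
      refine if_neg fun ⟨β, hβ, _⟩ => h1 ⟨⟨hi, hi'⟩, hβ ▸ β.2⟩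
    all_goals
      obtain ⟨h3, h4, h5⟩ := S.box_neighbour hi h1.2
      simp only [Option.elim]
      unfold preEntry
      rw [if_neg (by omega), if_neg (by omega)]
      simp only [h2, if_true, if_false]
      congr 1
      refine Finset.sum_congr rfl fun x _ => ?_
      congr 1
      rw [S.layer_box T (β := ⟨_, h1.2⟩) h4 h5 h3.symm]
      refine propext ⟨fun h => ⟨_, rfl, h⟩, fun ⟨β, hβ, h⟩ => ?_⟩
      have : β = ⟨_, h1.2⟩ := Subtype.ext hβ
      rw [← this]; exact h
  rw [hown, hoth, add_sub_add_left_eq_sub, ← Finset.sum_sub_distrib]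
  unfold allowed
  rw [if_pos ⟨hi, hi'⟩, Finset.sum_filter]
  refine Finset.sum_congr rfl fun x _ => ?_
  by_cases hA : ∀ β : D, β.1 = nextBox dir (S.box i c) → StepRel dir (c + 1) x (T β)
  · by_cases hB : ∃ β : D, β.1 = otherBox dir (S.box i c) ∧ StepRel dir (c + 1) x (T β)
    · rw [if_pos hA, if_pos hB, if_neg, sub_self]
      rintro ⟨-, h⟩
      obtain ⟨β, hβ, h'⟩ := hB
      exact h β hβ h'
    · rw [if_pos hA, if_neg hB, if_pos, sub_zero]
      exact ⟨hA, fun β hβ h => hB ⟨β, hβ, h⟩⟩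
  · have hB : ¬ ∃ β : D, β.1 = otherBox dir (S.box i c) ∧ StepRel dir (c + 1) x (T β) := by
      rintro ⟨γ, hγ, h⟩
      refine hA fun β hβ => ?_
      have := StepRel.of_otherBox hD (T := T) (by rw [hcb]; exact hT) hβ hγ (y := x)
        (by rw [hcb]; exact h)
      rwa [hcb] at this
    rw [if_neg hA, if_neg hB, if_neg, sub_self]
    exact fun h => hA h.1

theorem det_sum_allowed (hD : (D : Set Box).OrdConnected) (S : StripLabelling D dir b e) {c : ℤ}
    {T : D → Letter N} (hT : ValidFrom D (c + 1) T) :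
    (Matrix.of fun i j => ∑ y ∈ S.allowed c T i, entry w dir b e c i y j).det =
      (Matrix.of fun i j => preEntry w dir b e c i (S.layer (c + 1) T i) j).det := by
  set A := Matrix.of fun i j => preEntry w dir b e c i (S.layer (c + 1) T i) j with hA
  set M := Matrix.of fun i j => ∑ y ∈ S.allowed c T i, entry w dir b e c i y j with hM
  -- A strip missing the diagonal has the single dummy choice `⊤`, so its row is a sum with one
  -- term.
  have hM0 : ∀ i j, ¬ (b i ≤ c ∧ c ≤ e i) → M i j = entry w dir b e c i ⊤ j := by
    intro i j h
    simp [hM, allowed, h]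
  have hM1 : ∀ i j, b i ≤ c → c ≤ e i → M i j = A i j -
      (S.neighbour c i).elim (if b j = c + 1 then 1 else 0) (fun k => A k j) := by
    intro i j h1 h2
    have := S.sum_allowed w hD hT h1 h2 j
    simp only [hM, hA, Matrix.of_apply]
    rw [← this]
    refine Finset.sum_congr rfl fun y _ => ?_
    simp [entry, not_lt.2 h1, not_lt.2 h2]
  set B : Matrix (Fin r) (Fin r) ℂ := Matrix.of fun i j =>
    A i j - (S.neighbour c i).elim 0 (fun k => A k j) with hB
  have hBA : B.det = A.det :=
    det_eq_of_sub_higher_row A B (S.neighbour c) (S.rank c) (S.rank_lt_rank c) fun i j => rfl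
  have hBM : ∀ i, b i ≠ c + 1 → B i = M i := by
    intro i hi
    ext j
    by_cases h : b i ≤ c ∧ c ≤ e i
    · rw [hM1 i j h.1 h.2]
      simp only [hB, Matrix.of_apply]
      congr 1
      cases hn : S.neighbour c i with
      | some k => rfl
      | none =>
        simp only [Option.elim]
        -- Without a neighbour, `hM1` subtracts the birth constant while `B` subtracts 0;
        -- `otherBox_mem_of_start` shows that this constant is then 0.
        rw [if_neg]
        intro hj
        have := S.otherBox_mem_of_start hD h.1 h.2 hj
        simp [neighbour, h, this] at hn
    · rw [hM0 i j h]
      have hn : S.neighbour c i = none := by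
        unfold neighbour; rw [dif_neg (fun h' => h h'.1)]
      simp only [hB, hA, hn, Option.elim, sub_zero, Matrix.of_apply]
      unfold entry preEntry
      rcases lt_or_ge c (b i) with h1 | h1
      · rw [if_pos h1, if_pos (by omega)]
      · rw [if_neg (show ¬ c + 1 < b i by omega), if_neg (show ¬ c < b i by omega),
          if_pos (show e i < c + 1 by omega), if_pos (show e i < c by omega)]
  rw [← hBA]
  by_cases hbirth : ∃ k, b k = c + 1
  · obtain ⟨k, hk⟩ := hbirth
    have hle := S.le k
    have hne : ∀ i, i ≠ k → b i ≠ c + 1 := fun i hi h => hi (S.eq_of_start_eq hD (h.trans hk.symm))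
    -- Before its birth strip `k` has a unit row in `M`, and no other row reaches column `k`; hence
    -- the new row `k` matters only through its diagonal entry 1.
    refine (det_eq_of_unit_column M B k (fun i hi => ?_) (fun i hi => hBM i (hne i hi)) ?_).symm
    · have hcol : ∀ y, entry w dir b e c i y k = 0 := by
        intro y
        unfold entry
        split_ifs
        · rfl
        · exact total_of_lt w dir (by omega)
        · exact reach_of_lt w dir (by omega) y
      simp [hM, hcol]
    · rw [hM0 k k (by omega)]
      have hn : S.neighbour c k = none := by
        unfold neighbour; rw [dif_neg (fun h' => by omega)]
      simp only [hB, hA, hn, Option.elim, sub_zero, Matrix.of_apply]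
      unfold entry preEntry
      rw [if_pos (show c < b k by omega), if_neg (show ¬ c + 1 < b k by omega),
        if_neg (show ¬ e k < c + 1 by omega), if_pos hk, if_pos rfl]
      simp [reach_of_lt w dir (show c < b k by omega)]
  · push Not at hbirth
    congr 1
    ext i j
    rw [hBM i (hbirth i)]

end StripLabelling

/-! ### Adding and removing one diagonal, and the invariance of the partial sums. -/

namespace StripLabelling

variable {D : Finset Box} {dir : ℤ → Direction} {r : ℕ} {b e : Fin r → ℤ} {N : ℕ}

/-- The fillings of the boxes of content at least `c`; all other boxes carry `∞`. -/
def fillings (N : ℕ) (D : Finset Box) (c : ℤ) : Finset (D → Letter N) :=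
  Finset.univ.filter fun T => (∀ α : D, content α.1 < c → T α = ⊤) ∧ ValidFrom D c T

theorem mem_fillings {c : ℤ} {T : D → Letter N} :
    T ∈ fillings N D c ↔ (∀ α : D, content α.1 < c → T α = ⊤) ∧ ValidFrom D c T := by
  simp [fillings]

/-- Put the letters `u` on the diagonal of content `c`. -/
def insertLayer (S : StripLabelling D dir b e) (c : ℤ) (T : D → Letter N)
    (u : Fin r → Letter N) (α : D) : Letter N :=
  if content α.1 = c then u (S.lab α) else T α

theorem insertLayer_of_eq (S : StripLabelling D dir b e) {c : ℤ} (T : D → Letter N)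
    (u : Fin r → Letter N) {α : D} (h : content α.1 = c) :
    S.insertLayer c T u α = u (S.lab α) := if_pos h

theorem insertLayer_of_ne (S : StripLabelling D dir b e) {c : ℤ} (T : D → Letter N)
    (u : Fin r → Letter N) {α : D} (h : content α.1 ≠ c) : S.insertLayer c T u α = T α := if_neg h

/-- Remove the letters on the diagonal of content `c`. -/
def eraseLayer (c : ℤ) (T : D → Letter N) (α : D) : Letter N :=
  if content α.1 = c then ⊤ else T α

theorem mem_allowed_lab (S : StripLabelling D dir b e) {c : ℤ} {T : D → Letter N} {α : D}
    (hα : content α.1 = c) {y : Letter N} :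
    y ∈ S.allowed c T (S.lab α) ↔
      (∀ β : D, β.1 = nextBox dir α.1 → StepRel dir (c + 1) y (T β)) ∧
      (∀ β : D, β.1 = otherBox dir α.1 → ¬ StepRel dir (c + 1) y (T β)) := by
  have h : b (S.lab α) ≤ c ∧ c ≤ e (S.lab α) := hα ▸ ⟨S.start_le α, S.le_end α⟩
  have hb : S.box (S.lab α) c = α.1 := hα ▸ S.box_lab α
  unfold allowed
  rw [if_pos h, hb]
  simp

theorem insertLayer_mem (S : StripLabelling D dir b e) {c : ℤ} {T : D → Letter N}
    (hT : T ∈ fillings N D (c + 1)) {u : Fin r → Letter N}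
    (hu : ∀ i, u i ∈ S.allowed c T i) : S.insertLayer c T u ∈ fillings N D c := by
  rw [mem_fillings] at hT ⊢
  refine ⟨fun α hα => ?_, (validFrom_iff dir).2 fun α β hα => ?_⟩
  · rw [S.insertLayer_of_ne T u hα.ne]
    exact hT.1 α (by omega)
  · have key : content β.1 = content α.1 + 1 → S.insertLayer c T u β = T β := fun h =>
      S.insertLayer_of_ne T u (by omega)
    rcases hα.eq_or_lt with h | h
    · have hmem := (S.mem_allowed_lab h.symm).1 (hu (S.lab α))
      rw [S.insertLayer_of_eq T u h.symm, ← h]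
      refine ⟨fun hβ => ?_, fun hβ => ?_⟩
      · rw [key (by rw [hβ, content_nextBox])]
        exact hmem.1 β hβ
      · rw [key (by rw [hβ, content_otherBox])]
        exact hmem.2 β hβ
    · have hval := (validFrom_iff dir).1 hT.2 α β (by omega)
      rw [S.insertLayer_of_ne T u h.ne']
      refine ⟨fun hβ => ?_, fun hβ => ?_⟩
      · rw [key (by rw [hβ, content_nextBox])]
        exact hval.1 hβ
      · rw [key (by rw [hβ, content_otherBox])]
        exact hval.2 hβ

theorem eraseLayer_mem {c : ℤ} {T : D → Letter N}
    (hT : T ∈ fillings N D c) : eraseLayer c T ∈ fillings N D (c + 1) := by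
  rw [mem_fillings] at hT ⊢
  refine ⟨fun α hα => ?_, fun α β hα => ?_⟩
  · unfold eraseLayer
    split_ifs with h
    · rfl
    · exact hT.1 α (by omega)
  · have hval := hT.2 α β (by omega)
    have key : content β.1 = content α.1 + 1 → eraseLayer c T β = T β := fun h =>
      if_neg (by omega)
    have key' : eraseLayer c T α = T α := if_neg (by omega)
    rw [key']
    refine ⟨fun hβ => ?_, fun hβ => ?_⟩
    · rw [key (by rw [hβ]; simp only [content]; ring)]
      exact hval.1 hβ
    · rw [key (by rw [hβ]; simp only [content]; ring)]
      exact hval.2 hβ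

theorem layer_mem_allowed (S : StripLabelling D dir b e) {c : ℤ} {T : D → Letter N}
    (hT : T ∈ fillings N D c) (i : Fin r) : S.layer c T i ∈ S.allowed c (eraseLayer c T) i := by
  rw [mem_fillings] at hT
  by_cases h : b i ≤ c ∧ c ≤ e i
  · have hm := S.box_mem i c h.1 h.2
    have hc : content (S.box i c) = c := S.content_box i c h.1
    have hl : S.lab ⟨_, hm⟩ = i := S.lab_box i c h.1 h.2 hm
    have := S.layer_of_mem T ⟨_, hm⟩
    rw [hl] at this
    simp only [hc] at this
    suffices h' : T ⟨_, hm⟩ ∈ S.allowed c (eraseLayer c T) (S.lab ⟨_, hm⟩) by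
      rwa [hl, ← this] at h'
    rw [S.mem_allowed_lab (α := ⟨_, hm⟩) hc]
    have key : ∀ β : D, content β.1 = c + 1 → eraseLayer c T β = T β := fun β h =>
      if_neg (by omega)
    refine ⟨fun β hβ => ?_, fun β hβ => ?_⟩
    · rw [key β (by rw [hβ, content_nextBox, hc])]
      have := ((validFrom_iff dir).1 hT.2 ⟨_, hm⟩ β hc.ge).1 hβ
      rwa [hc] at this
    · rw [key β (by rw [hβ, content_otherBox, hc])]
      have := ((validFrom_iff dir).1 hT.2 ⟨_, hm⟩ β hc.ge).2 hβ
      rwa [hc] at this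
  · simp [layer, allowed, h]

theorem layer_insertLayer (S : StripLabelling D dir b e) {c : ℤ} {T : D → Letter N}
    {u : Fin r → Letter N} (hu : ∀ i, u i ∈ S.allowed c T i) :
    S.layer c (S.insertLayer c T u) = u := by
  funext i
  by_cases h : b i ≤ c ∧ c ≤ e i
  · have hm := S.box_mem i c h.1 h.2
    rw [S.layer_box _ (β := ⟨_, hm⟩) h.1 h.2 rfl,
      S.insertLayer_of_eq _ _ (S.content_box i c h.1), S.lab_box i c h.1 h.2 hm]
  · have := hu i
    simp only [allowed, h, if_false, Finset.mem_singleton] at this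
    simp [layer, h, this]

theorem eraseLayer_insertLayer (S : StripLabelling D dir b e) {c : ℤ} {T : D → Letter N}
    (hT : T ∈ fillings N D (c + 1)) (u : Fin r → Letter N) :
    eraseLayer c (S.insertLayer c T u) = T := by
  funext α
  unfold eraseLayer
  split_ifs with h
  · exact ((mem_fillings.1 hT).1 α (by omega)).symm
  · exact S.insertLayer_of_ne T u h

theorem insertLayer_eraseLayer (S : StripLabelling D dir b e) (c : ℤ) (T : D → Letter N) :
    S.insertLayer c (eraseLayer c T) (S.layer c T) = T := by
  funext α
  by_cases h : content α.1 = c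
  · rw [S.insertLayer_of_eq _ _ h, ← h, S.layer_of_mem]
  · rw [S.insertLayer_of_ne _ _ h]
    exact if_neg h

variable (w : ℤ → Letter N → ℂ)

/-- The sum over the fillings of the boxes of content at least `c`, weighted by the letters of
content larger than `c` and the determinant counting the beginnings of the strips. -/
def partialSum (S : StripLabelling D dir b e) (c : ℤ) : ℂ :=
  ∑ T ∈ fillings N D c,
    (∏ α : D, if c < content α.1 then w (content α.1) (T α) else 1) *
      (Matrix.of fun i j => entry w dir b e c i (S.layer c T i) j).det

theorem prod_layer (S : StripLabelling D dir b e) (c : ℤ) (T : D → Letter N) :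
    (∏ i, if b i ≤ c ∧ c ≤ e i then w c (S.layer c T i) else 1) =
      ∏ α : D, if content α.1 = c then w (content α.1) (T α) else 1 := by
  rw [← Finset.prod_filter, ← Finset.prod_filter]
  symm
  refine Finset.prod_bij (fun α _ => S.lab α) ?_ ?_ ?_ ?_
  · intro α hα
    rw [Finset.mem_filter] at hα ⊢
    exact ⟨Finset.mem_univ _, hα.2 ▸ ⟨S.start_le α, S.le_end α⟩⟩
  · intro α hα β hβ h
    rw [Finset.mem_filter] at hα hβ
    refine Subtype.ext ?_
    rw [← S.box_lab α, ← S.box_lab β, hα.2, hβ.2, h]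
  · intro i hi
    rw [Finset.mem_filter] at hi
    have hm := S.box_mem i c hi.2.1 hi.2.2
    refine ⟨⟨_, hm⟩, ?_, S.lab_box i c hi.2.1 hi.2.2 hm⟩
    rw [Finset.mem_filter]
    exact ⟨Finset.mem_univ _, S.content_box i c hi.2.1⟩
  · intro α hα
    rw [Finset.mem_filter] at hα
    rw [← S.layer_of_mem T α, hα.2]

/-- Boxes on one diagonal do not constrain each other, so a filling from `c` on is a filling from `c
+ 1` on together with independent allowed letters on the diagonal `c`. -/
theorem partialSum_succ (hD : (D : Set Box).OrdConnected) (S : StripLabelling D dir b e)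
    (c : ℤ) : S.partialSum w c = S.partialSum w (c + 1) := by
  have h1 : ∀ T ∈ fillings N D (c + 1),
      (∏ α : D, if c + 1 < content α.1 then w (content α.1) (T α) else 1) *
        (Matrix.of fun i j => entry w dir b e (c + 1) i (S.layer (c + 1) T i) j).det =
      ∑ u ∈ Fintype.piFinset (S.allowed c T),
        (∏ α : D, if c < content α.1 then w (content α.1) (T α) else 1) *
          (Matrix.of fun i j => entry w dir b e c i (u i) j).det := by
    intro T hT
    rw [← Finset.mul_sum]
    have hsum : ∑ u ∈ Fintype.piFinset (S.allowed c T),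
        (Matrix.of fun i j => entry w dir b e c i (u i) j).det =
        (Matrix.of fun i j => ∑ y ∈ S.allowed c T i, entry w dir b e c i y j).det := by
      -- Multilinearity in the rows turns the sum over independent choices into one determinant of
      -- row sums.
      have := (Matrix.detRowAlternating (R := ℂ) (n := Fin r)).toMultilinearMap.map_sum_finset
        (fun i y => fun j => entry w dir b e c i y j) (S.allowed c T)
      refine this.symm.trans ?_
      refine congrArg Matrix.det ?_
      ext i j
      simp
    have hmul : (Matrix.of fun i j => entry w dir b e (c + 1) i (S.layer (c + 1) T i) j).det =
        (∏ i, if b i ≤ c + 1 ∧ c + 1 ≤ e i then w (c + 1) (S.layer (c + 1) T i) else 1) *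
        (Matrix.of fun i j => preEntry w dir b e c i (S.layer (c + 1) T i) j).det := by
      rw [← Matrix.det_mul_column]
      refine congrArg Matrix.det ?_
      ext i j
      exact entry_succ w dir b e c i _ j
    rw [hsum, S.det_sum_allowed w hD (mem_fillings.1 hT).2, hmul, S.prod_layer w, ← mul_assoc,
      ← Finset.prod_mul_distrib]
    congr 1
    refine Finset.prod_congr rfl fun α _ => ?_
    rcases lt_trichotomy (content α.1) (c + 1) with h | h | h
    · rw [if_neg (by omega), if_neg (by omega), if_neg (by omega), one_mul]
    · rw [if_neg (by omega), if_pos h, if_pos (by omega), one_mul]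
    · rw [if_pos h, if_neg (by omega), if_pos (by omega), mul_one]
  unfold partialSum
  rw [Finset.sum_congr rfl h1, Finset.sum_sigma']
  symm
  refine Finset.sum_bij' (fun p _ => S.insertLayer c p.1 p.2)
    (fun T _ => ⟨eraseLayer c T, S.layer c T⟩) ?_ ?_ ?_ ?_ ?_
  · rintro ⟨T, u⟩ h
    rw [Finset.mem_sigma, Fintype.mem_piFinset] at h
    exact S.insertLayer_mem h.1 h.2
  · intro T hT
    rw [Finset.mem_sigma, Fintype.mem_piFinset]
    exact ⟨eraseLayer_mem hT, S.layer_mem_allowed hT⟩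
  · rintro ⟨T, u⟩ h
    rw [Finset.mem_sigma, Fintype.mem_piFinset] at h
    simp only [S.eraseLayer_insertLayer h.1, S.layer_insertLayer h.2]
  · intro T _
    exact S.insertLayer_eraseLayer c T
  · rintro ⟨T, u⟩ h
    rw [Finset.mem_sigma, Fintype.mem_piFinset] at h
    simp only [S.layer_insertLayer h.2]
    congr 1
    refine Finset.prod_congr rfl fun α _ => ?_
    split_ifs with hα
    · rw [S.insertLayer_of_ne _ _ hα.ne']
    · rfl

/-- The determinant formula for weights that depend on the content and the letter of a box. -/
theorem sum_validFrom_eq_det (hD : (D : Set Box).OrdConnected) (S : StripLabelling D dir b e)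
    {m : ℤ} (hm : ∀ i, m < b i) :
    ∑ T ∈ Finset.univ.filter (ValidFrom (N := N) D m), ∏ α : D, w (content α.1) (T α) =
      (Matrix.of fun i j => total w dir (b j) (e i)).det := by
  have hconst : ∀ n : ℕ, S.partialSum w (m + n) = S.partialSum w m := by
    intro n
    induction n with
    | zero => simp
    | succ n ih =>
      rw [← ih, S.partialSum_succ w hD (m + n)]
      congr 1
      push_cast
      ring
  have hcm : ∀ α : D, m < content α.1 := fun α => (hm _).trans_le (S.start_le α)
  have hstart : S.partialSum w m =
      ∑ T ∈ Finset.univ.filter (ValidFrom (N := N) D m), ∏ α : D, w (content α.1) (T α) := by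
    unfold partialSum
    refine Finset.sum_congr ?_ fun T _ => ?_
    · ext T
      rw [mem_fillings, Finset.mem_filter]
      exact ⟨fun h => ⟨Finset.mem_univ _, h.2⟩, fun h => ⟨fun α hα => absurd hα
        (hcm α).not_gt, h.2⟩⟩
    · have : (Matrix.of fun i j => entry w dir b e m i (S.layer m T i) j) = 1 := by
        ext i j
        simp [entry, hm i, Matrix.one_apply]
      rw [this, Matrix.det_one, mul_one]
      exact Finset.prod_congr rfl fun α _ => if_pos (hcm α)
  obtain ⟨n, hn⟩ : ∃ n : ℕ, ∀ i, e i < m + n := by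
    -- All summands are nonnegative, so the sum bounds each of them and `m + n` exceeds every ending
    -- content.
    refine ⟨(∑ i, (e i - m + 1)).toNat, fun i => ?_⟩
    have h0 : ∀ k, 0 ≤ e k - m + 1 := fun k => by have := hm k; have := S.le k; omega
    have := Finset.single_le_sum (fun k _ => h0 k) (Finset.mem_univ i)
    have := Int.self_le_toNat (∑ i, (e i - m + 1))
    omega
  have hcn : ∀ α : D, content α.1 < m + n := fun α => (S.le_end α).trans_lt (hn _)
  rw [← hstart, ← hconst n]
  unfold partialSum
  have hsing : fillings N D (m + n) = {fun _ => ⊤} := by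
    ext T
    rw [mem_fillings, Finset.mem_singleton]
    refine ⟨fun h => funext fun α => h.1 α (hcn α), ?_⟩
    rintro rfl
    exact ⟨fun _ _ => rfl, fun α β h => absurd h (hcn α).not_ge⟩
  rw [hsing, Finset.sum_singleton, Finset.prod_eq_one, one_mul]
  · congr 1
    ext i j
    have := hm i
    have := S.le i
    have := hn i
    simp [entry, hn i, show ¬ m + (n : ℤ) < b i by omega]
  · exact fun α _ => if_neg (hcn α).not_gt

end StripLabelling

/-! ### From so-tableaux to locally constrained weighted fillings. -/

/-- The contribution of the letter `x` in a box of content `c`. -/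
def weight {N : ℕ} (V : ℤ → ℂ) (c : ℤ) (x : Letter N) : ℂ :=
  if AtLeast (1 - c) x then 1 / absLetter x ^ V c else 0

theorem ValidFrom.rowRel {N : ℕ} {D : Finset Box} (hD : (D : Set Box).OrdConnected) {m : ℤ}
    (hm : ∀ α ∈ D, m ≤ content α) {T : D → Letter N} (hT : ValidFrom D m T) {α β : D}
    (h1 : α.1.1 = β.1.1) (h2 : α.1.2 < β.1.2) : RowRel (T α) (T β) := by
  obtain ⟨n, hn⟩ : ∃ n : ℕ, β.1.2 = α.1.2 + n + 1 := ⟨(β.1.2 - α.1.2 - 1).toNat, by omega⟩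
  induction n generalizing β with
  | zero => exact (hT α β (hm _ α.2)).1 (Prod.ext h1.symm (by simpa using hn))
  | succ n ih =>
    have hmem : (α.1.1, α.1.2 + n + 1) ∈ D :=
      mem_of_between hD α.2 β.2 le_rfl (by simp only; omega) h1.le (by simp only; omega)
    refine (ih (β := ⟨_, hmem⟩) rfl (by simp only; omega) rfl).trans ((hT ⟨_, hmem⟩ β (hm _ hmem)).1 ?_)
    exact Prod.ext h1.symm (by simp only; omega)

theorem ValidFrom.colRel {N : ℕ} {D : Finset Box} (hD : (D : Set Box).OrdConnected) {m : ℤ}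
    (hm : ∀ α ∈ D, m ≤ content α) {T : D → Letter N} (hT : ValidFrom D m T) {α β : D}
    (h1 : α.1.2 = β.1.2) (h2 : β.1.1 < α.1.1) : ¬ RowRel (T α) (T β) := by
  obtain ⟨n, hn⟩ : ∃ n : ℕ, β.1.1 = α.1.1 - n - 1 := ⟨(α.1.1 - β.1.1 - 1).toNat, by omega⟩
  induction n generalizing β with
  | zero => exact (hT α β (hm _ α.2)).2 (Prod.ext (by simpa using hn) h1.symm)
  | succ n ih =>
    have hmem : (α.1.1 - n - 1, α.1.2) ∈ D :=
      mem_of_between hD β.2 α.2 (by simp only; omega) h1.ge (by simp only; omega) le_rfl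
    refine not_rowRel_trans (ih (β := ⟨_, hmem⟩) rfl (by simp only; omega) rfl)
      ((hT ⟨_, hmem⟩ β (hm _ hmem)).2 ?_)
    refine Prod.ext ?_ h1.symm
    simp only [hn]
    push_cast
    ring

/-- Rows and columns of a convex set have no gaps, and both `RowRel` and its negation are
transitive, so adjacent boxes suffice. -/
theorem isSoTableau_iff {N : ℕ} {D : Finset Box} (hD : (D : Set Box).OrdConnected) {m : ℤ}
    (hm : ∀ α ∈ D, m ≤ content α) {T : D → Letter N} :
    IsSoTableau N D T ↔ ValidFrom D m T ∧ ∀ α : D, AtLeast (1 - content α.1) (T α) := by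
  constructor
  · intro h
    refine ⟨fun α β _ => ⟨fun hβ => ⟨?_, fun ⟨h1, h2⟩ => ?_⟩, fun hβ => ?_⟩, fun α => ?_⟩
    · exact h.row_weak α β (by rw [hβ]) (by rw [hβ]; simp)
    · have := h.top_row α β (by rw [hβ]) h1 h2
      rw [← this] at hβ
      have := congrArg Prod.snd hβ
      simp at this
    · rw [not_rowRel_iff]
      exact h.col_strict β α (by rw [hβ]) (by rw [hβ]; simp)
    · have := h.symplectic α (-content α.1) (by simp)
      rwa [show (1 : ℤ) - content α.1 = -content α.1 + 1 by ring]
  · rintro ⟨h, hs⟩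
    refine ⟨fun α β h1 h2 => ?_, fun α β h1 h2 => ?_, fun α i hi => ?_, fun α β h1 h2 h3 => ?_⟩
    · rcases h2.eq_or_lt with h2 | h2
      · rw [Subtype.ext (Prod.ext h1 h2)]
      · exact (h.rowRel hD hm h1 h2).1
    · exact not_rowRel_iff.1 (h.colRel hD hm h1.symm h2)
    · have := hs α
      rwa [hi, show (1 : ℤ) - -i = i + 1 by ring] at this
    · rcases lt_trichotomy α.1.2 β.1.2 with h4 | h4 | h4
      · exact absurd ⟨h2, h3⟩ (h.rowRel hD hm h1 h4).2
      · exact Subtype.ext (Prod.ext h1 h4)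
      · exact absurd ⟨h3, h2⟩ (h.rowRel hD hm h1.symm h4).2

/-- The lower bound on entries is moved from the summation range into `weight`, which vanishes where
it fails. -/
theorem soZeta_eq_sum {N : ℕ} {D : Finset Box} (hD : (D : Set Box).OrdConnected) {m : ℤ}
    (hm : ∀ α ∈ D, m ≤ content α) (V : ℤ → ℂ) :
    soZeta N D (fun α => V (content α.1)) =
      ∑ T ∈ Finset.univ.filter (ValidFrom (N := N) D m),
        ∏ α : D, weight V (content α.1) (T α) := by
  unfold soZeta
  rw [Finset.sum_filter, Finset.sum_filter]
  refine Finset.sum_congr rfl fun T _ => ?_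
  have hw : ∏ α : D, weight V (content α.1) (T α) =
      if ∀ α : D, AtLeast (1 - content α.1) (T α) then
        1 / ∏ α : D, absLetter (T α) ^ V (content α.1) else 0 := by
    unfold weight
    rw [Finset.prod_ite_zero]
    simp
  rw [hw, isSoTableau_iff hD hm]
  by_cases h1 : ValidFrom D m T <;> simp [h1]

/-! ### Directed strips and the entries of the determinant. -/

theorem content_iterate_nextBox (dir : ℤ → Direction) (α : Box) (n : ℕ) :
    content ((nextBox dir)^[n] α) = content α + n := by
  induction n with
  | zero => simp
  | succ n ih =>
    rw [Function.iterate_succ_apply', content_nextBox, ih]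
    push_cast
    ring

/-- A family of disjoint directed strips as a `StripLabelling` of its union. -/
def StripLabelling.ofStrips {D : Finset Box} {dir : ℤ → Direction} {r : ℕ}
    (θ : Fin r → Finset Box) (st : Fin r → Box) (e : Fin r → ℤ)
    (hdisj : ∀ k l, k ≠ l → Disjoint (θ k) (θ l)) (hunion : ∀ α, α ∈ D ↔ ∃ k, α ∈ θ k)
    (hle : ∀ k, content (st k) ≤ e k)
    (hmem : ∀ k α, α ∈ θ k ↔ content (st k) ≤ content α ∧ content α ≤ e k ∧
      (nextBox dir)^[(content α - content (st k)).toNat] (st k) = α)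
    (hnext : ∀ k, ∀ α ∈ θ k, nextBox dir α ∈ D → nextBox dir α ∈ θ k) :
    StripLabelling D dir (fun k => content (st k)) e :=
  have hc : ∀ i c, content (st i) ≤ c →
      content ((nextBox dir)^[(c - content (st i)).toNat] (st i)) = c := fun i c h => by
    rw [content_iterate_nextBox]; omega
  have hm : ∀ i c, content (st i) ≤ c → c ≤ e i →
      (nextBox dir)^[(c - content (st i)).toNat] (st i) ∈ θ i := fun i c h h' => by
    rw [hmem, hc i c h]; exact ⟨h, h', rfl⟩
  have hlab : ∀ α : D, α.1 ∈ θ ((hunion α.1).1 α.2).choose := fun α =>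
    ((hunion α.1).1 α.2).choose_spec
  { box := fun k c => (nextBox dir)^[(c - content (st k)).toNat] (st k)
    lab := fun α => ((hunion α.1).1 α.2).choose
    le := hle
    content_box := hc
    box_succ := fun i c h => by
      rw [← Function.iterate_succ_apply' (nextBox dir)]
      congr 1
      omega
    box_mem := fun i c h h' => (hunion _).2 ⟨i, hm i c h h'⟩
    lab_box := fun i c h h' hmemD => by
      by_contra hne
      exact Finset.disjoint_left.1 (hdisj _ _ hne) (hlab ⟨_, hmemD⟩) (hm i c h h')
    start_le := fun α => ((hmem _ _).1 (hlab α)).1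
    le_end := fun α => ((hmem _ _).1 (hlab α)).2.1
    box_lab := fun α => ((hmem _ _).1 (hlab α)).2.2
    lt_end := fun i c h h' hD => by
      have := ((hmem _ _).1 (hnext i _ (hm i c h h') hD)).2.1
      rw [content_nextBox, hc i c h] at this
      omega }

/-- The strip directed by `dir` with the starting box `st` and last content `e`. -/
def directedStrip (dir : ℤ → Direction) (st : Box) (e : ℤ) : Finset Box :=
  (Finset.range (e + 1 - content st).toNat).image fun n => (nextBox dir)^[n] st

theorem mem_directedStrip {dir : ℤ → Direction} {st : Box} {e : ℤ} {α : Box} :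
    α ∈ directedStrip dir st e ↔ content st ≤ content α ∧ content α ≤ e ∧
      (nextBox dir)^[(content α - content st).toNat] st = α := by
  unfold directedStrip
  rw [Finset.mem_image]
  constructor
  · rintro ⟨n, hn, rfl⟩
    rw [Finset.mem_range] at hn
    rw [content_iterate_nextBox]
    refine ⟨by omega, by omega, ?_⟩
    congr 1
    omega
  · rintro ⟨h1, h2, h3⟩
    exact ⟨_, Finset.mem_range.2 (by omega), h3⟩

theorem antitone_fst_iterate (dir : ℤ → Direction) (st : Box) :
    Antitone fun n : ℕ => ((nextBox dir)^[n] st).1 := by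
  refine antitone_nat_of_succ_le fun n => ?_
  rw [Function.iterate_succ_apply']
  generalize (nextBox dir)^[n] st = α
  unfold nextBox
  cases dir (content α + 1) <;> simp

theorem monotone_snd_iterate (dir : ℤ → Direction) (st : Box) :
    Monotone fun n : ℕ => ((nextBox dir)^[n] st).2 := by
  refine monotone_nat_of_le_succ fun n => ?_
  rw [Function.iterate_succ_apply']
  generalize (nextBox dir)^[n] st = α
  unfold nextBox
  cases dir (content α + 1) <;> simp

theorem ordConnected_directedStrip (dir : ℤ → Direction) (st : Box) (e : ℤ) :
    (directedStrip dir st e : Set Box).OrdConnected := by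
  refine ⟨fun x hx z hz y hy => ?_⟩
  rw [Finset.mem_coe] at hx hz ⊢
  obtain ⟨⟨h1, h2⟩, h3, h4⟩ := hy
  unfold directedStrip at hx hz ⊢
  rw [Finset.mem_image] at hx hz ⊢
  obtain ⟨m, hm, rfl⟩ := hx
  obtain ⟨n, hn, rfl⟩ := hz
  rw [Finset.mem_range] at hm hn
  have cm := content_iterate_nextBox dir st m
  have cn := content_iterate_nextBox dir st n
  have hk : ∀ k : ℕ, (k : ℤ) = content y - content st →
      (((nextBox dir)^[k] st).1 = y.1 ∨ ((nextBox dir)^[k] st).2 = y.2) →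
      (nextBox dir)^[k] st = y := by
    intro k hk h
    have := content_iterate_nextBox dir st k
    unfold content at this hk
    refine Prod.ext ?_ ?_ <;> omega
  have m1 := antitone_fst_iterate dir st
  have m2 := monotone_snd_iterate dir st
  -- The path runs upwards and to the right, while `x ≤ z` componentwise. So if `x` comes first, the
  -- segment between them has constant row; otherwise it has constant column.
  rcases le_total m n with h | h
  · have e1 := m1 h
    simp only at e1
    have hcy : content st + m ≤ content y ∧ content y ≤ content st + n := by
      rw [← cm, ← cn]
      unfold content
      omega
    obtain ⟨k, hk'⟩ : ∃ k : ℕ, (k : ℤ) = content y - content st :=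
      ⟨(content y - content st).toNat, by omega⟩
    refine ⟨k, Finset.mem_range.2 (by omega), hk k hk' (Or.inl ?_)⟩
    have e2 := m1 (show m ≤ k by omega)
    have e3 := m1 (show k ≤ n by omega)
    simp only at e2 e3
    omega
  · have e1 := m2 h
    simp only at e1
    have hcy : content st + n ≤ content y ∧ content y ≤ content st + m := by
      rw [← cm, ← cn]
      unfold content
      omega
    obtain ⟨k, hk'⟩ : ∃ k : ℕ, (k : ℤ) = content y - content st :=
      ⟨(content y - content st).toNat, by omega⟩
    refine ⟨k, Finset.mem_range.2 (by omega), hk k hk' (Or.inr ?_)⟩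
    have e2 := m2 (show n ≤ k by omega)
    have e3 := m2 (show k ≤ m by omega)
    simp only at e2 e3
    omega

theorem StripLabelling.soZeta_eq_det {N : ℕ} {D : Finset Box}
    (hD : (D : Set Box).OrdConnected) {dir : ℤ → Direction} {r : ℕ} {b e : Fin r → ℤ}
    (S : StripLabelling D dir b e) (V : ℤ → ℂ) :
    soZeta N D (fun α => V (content α.1)) =
      (Matrix.of fun i j => total (N := N) (weight V) dir (b j) (e i)).det := by
  obtain ⟨m, hm⟩ : ∃ m : ℤ, ∀ i, m < b i := by
    obtain ⟨m, hm⟩ := (Set.finite_range b).bddBelow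
    exact ⟨m - 1, fun i => by have := hm (Set.mem_range_self i); omega⟩
  rw [soZeta_eq_sum hD (m := m) (fun α hα => (hm _).le.trans (S.start_le ⟨α, hα⟩)),
    S.sum_validFrom_eq_det (weight V) hD hm]

/-- The strip is a decomposition of itself, so this is the 1 × 1 case of the determinant formula. -/
theorem soZeta_directedStrip {N : ℕ} (dir : ℤ → Direction) (st : Box) {e : ℤ}
    (h : content st ≤ e) (V : ℤ → ℂ) :
    soZeta N (directedStrip dir st e) (fun α => V (content α.1)) =
      total (N := N) (weight V) dir (content st) e := by
  have S := StripLabelling.ofStrips (D := directedStrip dir st e) (dir := dir)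
    (fun _ : Fin 1 => directedStrip dir st e) (fun _ => st) (fun _ => e)
    (fun k l hkl => absurd (Subsingleton.elim k l) hkl) (fun α => by simp) (fun _ => h)
    (fun _ α => mem_directedStrip) (fun _ α _ hα => hα)
  rw [S.soZeta_eq_det (ordConnected_directedStrip dir st e) V, Matrix.det_fin_one]
  rfl

/-- The conventions 1 for an empty and 0 for an undefined `θ₁ # θ₂` are exactly the boundary values
of `total`. -/
theorem hashZeta_eq_total {N : ℕ} {D : Finset Box} (s : D → ℂ) (fill : ℤ → ℂ)
    (dir : ℤ → Direction) (θ₁ θ₂ : Finset Box) :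
    hashZeta N D s fill dir θ₁ θ₂ = total (N := N) (weight (diagEntry D s fill)) dir
      (content (startBox θ₂)) (content (endBox θ₁)) := by
  unfold hashZeta
  split_ifs with h
  · unfold HashDefined at h
    rcases h.eq_or_lt with h | h
    · rw [total_self _ _ h]
      have hempty : hash dir θ₁ θ₂ = ∅ := by
        unfold hash
        rw [h, sub_self]
        rfl
      rw [hempty]
      have : IsSoTableau N ∅ (fun _ => ⊤) :=
        ⟨fun α => absurd α.2 (Finset.notMem_empty _), fun α => absurd α.2 (Finset.notMem_empty _),
          fun α => absurd α.2 (Finset.notMem_empty _), fun α => absurd α.2 (Finset.notMem_empty _)⟩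
      have hfilter : (Finset.univ : Finset ((∅ : Finset Box) → Letter N)).filter
          (IsSoTableau N ∅) = {fun _ => ⊤} := by
        ext T
        have hT : T = fun _ => ⊤ := funext fun α => absurd α.2 (Finset.notMem_empty _)
        rw [Finset.mem_filter, Finset.mem_singleton, hT]
        exact ⟨fun _ => rfl, fun _ => ⟨Finset.mem_univ _, this⟩⟩
      unfold soZeta
      rw [hfilter]
      simp
    · exact soZeta_directedStrip dir (startBox θ₂) (by omega) (diagEntry D s fill)
  · unfold HashDefined at h
    rw [total_of_lt _ _ (by omega)]

theorem diagEntry_content {D : Finset Box} {s : D → ℂ} (hs : IsDiagConst D s) (fill : ℤ → ℂ)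
    (α : D) : diagEntry D s fill (content α.1) = s α := by
  have h : ∃ β : D, content β.1 = content α.1 := ⟨α, rfl⟩
  unfold diagEntry
  rw [dif_pos h]
  exact hs _ _ h.choose_spec

/-! ### Geometry of strips and outside decompositions. -/

theorem ordConnected_skewDiagram (lam mu : YoungDiagram) :
    (skewDiagram lam mu : Set Box).OrdConnected := by
  refine ⟨fun x hx z hz y hy => ?_⟩
  obtain ⟨⟨h1, h2⟩, h3, h4⟩ := hy
  simp only [skewDiagram, Finset.mem_coe, Finset.mem_image, Finset.mem_sdiff,
    YoungDiagram.mem_cells] at hx hz ⊢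
  obtain ⟨⟨a, a'⟩, ⟨-, ha⟩, rfl⟩ := hx
  obtain ⟨⟨c, c'⟩, ⟨hc, -⟩, rfl⟩ := hz
  obtain ⟨b, hb⟩ := Int.eq_ofNat_of_zero_le ((Int.natCast_nonneg a).trans h1)
  obtain ⟨b', hb'⟩ := Int.eq_ofNat_of_zero_le ((Int.natCast_nonneg a').trans h2)
  simp only at h1 h2 h3 h4
  refine ⟨(b, b'), ⟨lam.up_left_mem (by omega) (by omega) hc, fun h => ha ?_⟩,
    Prod.ext hb.symm hb'.symm⟩
  exact mu.up_left_mem (by omega) (by omega) h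

namespace IsStrip

variable {θ : Finset Box}

/-- A box of a strip other than the starting box has a left or a lower neighbour in the strip. -/
theorem exists_pred (h : IsStrip θ) {s α : Box} (hs : IsStartBox θ s) (hα : α ∈ θ) (hne : α ≠ s) :
    (α.1, α.2 - 1) ∈ θ ∨ (α.1 + 1, α.2) ∈ θ := by
  by_contra! hcon
  -- If both neighbours were missing, convexity would confine every path from `α` in the strip to
  -- the boxes weakly above and to the right; then the starting box could only be `α`.
  have key : ∀ x, Relation.ReflTransGen (fun x y => x ∈ θ ∧ y ∈ θ ∧ EdgeAdj x y) α x →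
      x.1 ≤ α.1 ∧ α.2 ≤ x.2 := by
    intro x hx
    induction hx with
    | refl => exact ⟨le_rfl, le_rfl⟩
    | @tail x y _ hxy ih =>
      obtain ⟨-, hy, hadj⟩ := hxy
      by_contra hout
      unfold EdgeAdj at hadj
      rcases (show (α.1 < y.1 ∧ α.2 ≤ y.2) ∨ (y.1 ≤ α.1 ∧ y.2 < α.2) by omega) with h1 | h1
      · exact hcon.2 (mem_of_between h.skew hα hy (by simp) (by simp) (by simp only; omega)
          (by simp only; omega))
      · exact hcon.1 (mem_of_between h.skew hy hα (by simp only; omega) (by simp only; omega)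
          (by simp) (by simp))
  obtain ⟨h1, h2⟩ := key s (h.connected α hα s hs.1)
  obtain ⟨h3, h4⟩ := hs.2 α hα
  exact hne (Prod.ext (by omega) (by omega))

/-- A box of a strip other than the ending box has a right or an upper neighbour in the strip. -/
theorem exists_succ (h : IsStrip θ) {t γ : Box} (ht : IsEndBox θ t) (hγ : γ ∈ θ) (hne : γ ≠ t) :
    (γ.1, γ.2 + 1) ∈ θ ∨ (γ.1 - 1, γ.2) ∈ θ := by
  by_contra! hcon
  have key : ∀ x, Relation.ReflTransGen (fun x y => x ∈ θ ∧ y ∈ θ ∧ EdgeAdj x y) γ x →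
      γ.1 ≤ x.1 ∧ x.2 ≤ γ.2 := by
    intro x hx
    induction hx with
    | refl => exact ⟨le_rfl, le_rfl⟩
    | @tail x y _ hxy ih =>
      obtain ⟨-, hy, hadj⟩ := hxy
      by_contra hout
      unfold EdgeAdj at hadj
      rcases (show (y.1 < γ.1 ∧ y.2 ≤ γ.2) ∨ (γ.1 ≤ y.1 ∧ γ.2 < y.2) by omega) with h1 | h1
      · exact hcon.2 (mem_of_between h.skew hy hγ (by simp only; omega) (by simp only; omega)
          (by simp) (by simp))
      · exact hcon.1 (mem_of_between h.skew hγ hy (by simp) (by simp) (by simp only; omega)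
          (by simp only; omega))
  obtain ⟨h1, h2⟩ := key t (h.connected γ hγ t ht.1)
  obtain ⟨h3, h4⟩ := ht.2 γ hγ
  exact hne (Prod.ext (by omega) (by omega))

theorem notMem_below (h : IsStrip θ) {α : Box} (hα : α ∈ θ) (h1 : (α.1, α.2 - 1) ∈ θ) :
    (α.1 + 1, α.2) ∉ θ := by
  intro h2
  refine h.no_block α.1 (α.2 - 1) ⟨h1, by simpa using hα, ?_, by simpa using h2⟩
  exact mem_of_between h.skew h1 h2 (by simp) (by simp) (by simp) (by simp)

theorem notMem_above (h : IsStrip θ) {γ : Box} (hγ : γ ∈ θ) (h1 : (γ.1, γ.2 + 1) ∈ θ) :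
    (γ.1 - 1, γ.2) ∉ θ := by
  intro h2
  refine h.no_block (γ.1 - 1) γ.2 ⟨h2, ?_, by simpa using hγ, by simpa using h1⟩
  exact mem_of_between h.skew h2 h1 (by simp) (by simp) (by simp) (by simp)

end IsStrip

theorem IsStartBox.unique {θ : Finset Box} {α β : Box} (hα : IsStartBox θ α)
    (hβ : IsStartBox θ β) : α = β := by
  have h1 := hα.2 β hβ.1
  have h2 := hβ.2 α hα.1
  exact Prod.ext (by omega) (by omega)

namespace IsOutsideDecomposition

variable {D : Finset Box} {r : ℕ} {θ : Fin r → Finset Box}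

theorem mem (h : IsOutsideDecomposition D θ) {k : Fin r} {α : Box} (hα : α ∈ θ k) : α ∈ D :=
  (h.union α).2 ⟨k, hα⟩

theorem index_eq (h : IsOutsideDecomposition D θ) {k l : Fin r} {α : Box} (hk : α ∈ θ k)
    (hl : α ∈ θ l) : k = l := by
  by_contra hne
  exact Finset.disjoint_left.1 (h.disjoint k l hne) hk hl

theorem isStartBox (h : IsOutsideDecomposition D θ) (k : Fin r) :
    IsStartBox (θ k) (startBox (θ k)) :=
  Classical.epsilon_spec (p := IsStartBox (θ k))
    ((h.start_perimeter k).imp fun _ hα => hα.1)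

theorem isEndBox (h : IsOutsideDecomposition D θ) (k : Fin r) :
    IsEndBox (θ k) (endBox (θ k)) :=
  Classical.epsilon_spec (p := IsEndBox (θ k)) ((h.end_perimeter k).imp fun _ hα => hα.1)

/-- Every box is approached from at least one direction. -/
theorem isApproached_left_or_below (h : IsOutsideDecomposition D θ) {k : Fin r} {α : Box}
    (hα : α ∈ θ k) : IsApproached D (θ k) α .left ∨ IsApproached D (θ k) α .below := by
  obtain ⟨s, hs, hp⟩ := h.start_perimeter k
  by_cases hαs : α = s
  · subst hαs
    exact hp.imp (fun hp => Or.inr ⟨hs, hp⟩) (fun hp => Or.inr ⟨hs, hp⟩)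
  · exact ((h.strip k).exists_pred hs hα hαs).imp Or.inl Or.inl

/-- Two neighbours on a diagonal are both approached from the left or both not. -/
theorem isApproached_left_iff_of_diagonal (hD : (D : Set Box).OrdConnected)
    (h : IsOutsideDecomposition D θ) {k l : Fin r} {α : Box} (hα : α ∈ θ k)
    (hβ : (α.1 + 1, α.2 + 1) ∈ θ l) :
    IsApproached D (θ k) α .left ↔ IsApproached D (θ l) (α.1 + 1, α.2 + 1) .left := by
  have hγD : (α.1 + 1, α.2) ∈ D :=
    mem_of_between hD (h.mem hα) (h.mem hβ) (by simp) (by simp) (by simp) (by simp)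
  obtain ⟨m, hγ⟩ := (h.union _).1 hγD
  -- The box below `α` and left of its diagonal neighbour lies in exactly one of their strips. It
  -- cannot end its own strip, since its right and upper neighbours are in `D`, and it cannot
  -- precede both, since a strip has no 2 × 2 block.
  have hxor : k ≠ m ↔ l = m := by
    constructor
    · intro hkm
      obtain ⟨t, ht, hp⟩ := h.end_perimeter m
      have hne : (α.1 + 1, α.2) ≠ t := by
        rintro rfl
        rcases hp with hp | hp
        · exact hp.2 (h.mem hβ)
        · exact hp.2 (by simpa using h.mem hα)
      rcases (h.strip m).exists_succ ht hγ hne with h1 | h1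
      · exact h.index_eq hβ h1
      · exact absurd (h.index_eq hα (by simpa using h1)) hkm
    · rintro rfl rfl
      exact (h.strip k).notMem_above hγ hβ (by simpa using hα)
  have hleft : IsApproached D (θ k) α .left ↔ k ≠ m := by
    constructor
    · rintro (h1 | ⟨h1, -⟩) rfl
      · exact (h.strip k).notMem_below hα h1 hγ
      · have := (h1.2 _ hγ).1
        simp at this
    · intro hkm
      rcases h.isApproached_left_or_below hα with h1 | h1 | ⟨-, h1⟩
      · exact h1
      · exact absurd (h.index_eq h1 hγ) hkm
      · exact absurd hγD h1.2
  rw [hleft, hxor]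
  constructor
  · rintro rfl
    exact Or.inl (by simpa using hγ)
  · rintro (h1 | ⟨-, h1⟩)
    · exact h.index_eq (by simpa using h1) hγ
    · exact absurd (by simpa using hγD) h1.2

theorem isApproached_left_iff (hD : (D : Set Box).OrdConnected)
    (h : IsOutsideDecomposition D θ) {k l : Fin r} {α β : Box} (hα : α ∈ θ k) (hβ : β ∈ θ l)
    (hc : content α = content β) :
    IsApproached D (θ k) α .left ↔ IsApproached D (θ l) β .left := by
  wlog hle : α.1 ≤ β.1 generalizing α β k l
  · exact (this hβ hα hc.symm (by omega)).symm
  obtain ⟨n, hn⟩ := Int.le.dest hle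
  unfold content at hc
  obtain ⟨β₁, β₂⟩ := β
  simp only at hn hc
  obtain rfl : β₂ = α.2 + n := by omega
  subst hn
  clear hle hc
  induction n generalizing l with
  | zero =>
    simp only [Nat.cast_zero, add_zero] at hβ ⊢
    rw [h.index_eq hα hβ]
  | succ n ih =>
    have hmem : (α.1 + n, α.2 + n) ∈ D :=
      mem_of_between hD (h.mem hα) (h.mem hβ) (by simp) (by simp) (by simp) (by simp)
    obtain ⟨m, hm⟩ := (h.union _).1 hmem
    push_cast at hβ ⊢
    rw [← add_assoc, ← add_assoc] at hβ ⊢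
    exact (ih hm).trans (h.isApproached_left_iff_of_diagonal hD hm hβ)

/-- Every outside decomposition of a skew diagram has an approach rule. -/
theorem exists_isApproachRule (hD : (D : Set Box).OrdConnected)
    (h : IsOutsideDecomposition D θ) : ∃ dir : ℤ → Direction, IsApproachRule D θ dir := by
  refine ⟨fun c => if ∃ l, ∃ β ∈ θ l, content β = c ∧ IsApproached D (θ l) β .left then .left
    else .below, fun k α hα => ?_⟩
  simp only
  split_ifs with hex
  · obtain ⟨l, β, hβ, hc, hleft⟩ := hex
    exact (h.isApproached_left_iff hD hβ hα hc).1 hleft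
  · exact (h.isApproached_left_or_below hα).resolve_left fun hl => hex ⟨k, α, hα, rfl, hl⟩

variable {dir : ℤ → Direction}

theorem prevBox_mem_or (hdir : IsApproachRule D θ dir) {k : Fin r} {α : Box} (hα : α ∈ θ k) :
    prevBox dir α ∈ θ k ∨ (IsStartBox (θ k) α ∧ prevBox dir α ∉ D) := by
  have := hdir k α hα
  unfold prevBox
  cases hd : dir (content α) <;> rw [hd] at this
  · exact this.imp_right fun h => ⟨h.1, h.2.2⟩
  · exact this.imp_right fun h => ⟨h.1, h.2.2⟩

theorem iterate_nextBox_of_mem (h : IsOutsideDecomposition D θ) (hdir : IsApproachRule D θ dir)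
    {k : Fin r} (n : ℕ) {α : Box} (hα : α ∈ θ k) (hn : content α = content (startBox (θ k)) + n) :
    (nextBox dir)^[n] (startBox (θ k)) = α := by
  induction n generalizing α with
  | zero =>
    have := (h.isStartBox k).2 α hα
    unfold content at hn
    exact Prod.ext (by simp; omega) (by simp; omega)
  | succ n ih =>
    have hp : prevBox dir α ∈ θ k := by
      refine (prevBox_mem_or hdir hα).resolve_right fun hs => ?_
      rw [hs.1.unique (h.isStartBox k)] at hn
      push_cast at hn
      omega
    rw [Function.iterate_succ_apply', ih hp, nextBox_prevBox]
    rw [content_prevBox, hn]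
    push_cast
    ring

theorem iterate_nextBox_mem (h : IsOutsideDecomposition D θ) (hdir : IsApproachRule D θ dir)
    {k : Fin r} (n m : ℕ)
    (hn : content (endBox (θ k)) = content (startBox (θ k)) + (n + m : ℕ)) :
    (nextBox dir)^[n] (startBox (θ k)) ∈ θ k := by
  -- Induction on the distance to the ending box, walking backwards along predecessors.
  induction m generalizing n with
  | zero =>
    rw [h.iterate_nextBox_of_mem hdir n (h.isEndBox k).1 hn]
    exact (h.isEndBox k).1
  | succ m ih =>
    have hmem := ih (n + 1) (by rw [hn]; push_cast; ring)
    have hc := content_iterate_nextBox dir (startBox (θ k)) (n + 1)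
    have := (prevBox_mem_or hdir hmem).resolve_right fun hs => by
      rw [hs.1.unique (h.isStartBox k)] at hc
      push_cast at hc
      omega
    rwa [Function.iterate_succ_apply', prevBox_nextBox] at this

/-- An outside decomposition with an approach rule consists of directed strips. -/
def toStripLabelling (h : IsOutsideDecomposition D θ) (hdir : IsApproachRule D θ dir) :
    StripLabelling D dir (fun k => content (startBox (θ k)))
      (fun k => content (endBox (θ k))) :=
  have hstart : ∀ k, ∀ α ∈ θ k, content (startBox (θ k)) ≤ content α := fun k α hα => by
    have := (h.isStartBox k).2 α hα
    unfold content
    omega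
  have hend : ∀ k, ∀ α ∈ θ k, content α ≤ content (endBox (θ k)) := fun k α hα => by
    have := (h.isEndBox k).2 α hα
    unfold content
    omega
  StripLabelling.ofStrips θ (fun k => startBox (θ k)) (fun k => content (endBox (θ k)))
    h.disjoint h.union (fun k => hend k _ (h.isStartBox k).1)
    (fun k α => by
      constructor
      · intro hα
        have h1 := hstart k α hα
        exact ⟨h1, hend k α hα, h.iterate_nextBox_of_mem hdir _ hα (by omega)⟩
      · rintro ⟨h1, h2, h3⟩
        rw [← h3]
        exact h.iterate_nextBox_mem hdir _ (content (endBox (θ k)) - content α).toNat (by omega))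
    (fun k α hα hnext => by
      -- The next box lies in some strip, which must contain its predecessor `α`, because a
      -- predecessor missing from the strip is missing from `D`.
      obtain ⟨l, hl⟩ := (h.union _).1 hnext
      rcases prevBox_mem_or hdir hl with h1 | ⟨-, h1⟩
      · rw [prevBox_nextBox] at h1
        rwa [h.index_eq hα h1]
      · rw [prevBox_nextBox] at h1
        exact absurd (h.mem hα) h1)

end IsOutsideDecomposition

end SchurSo

end

theorem mainTheorem7 (N : ℕ) (hN : 0 < N) (lam mu : YoungDiagram) (hmu : mu ≤ lam)
    (s : SchurSo.skewDiagram lam mu → ℂ)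
    (hs : SchurSo.IsDiagConst (SchurSo.skewDiagram lam mu) s)
    (r : ℕ) (θ : Fin r → Finset SchurSo.Box)
    (hθ : SchurSo.IsOutsideDecomposition (SchurSo.skewDiagram lam mu) θ) :
    (∃ dir : ℤ → SchurSo.Direction,
      SchurSo.IsApproachRule (SchurSo.skewDiagram lam mu) θ dir) ∧
    ∀ dir : ℤ → SchurSo.Direction,
      SchurSo.IsApproachRule (SchurSo.skewDiagram lam mu) θ dir →
      ∀ fill : ℤ → ℂ,
        SchurSo.soZeta N (SchurSo.skewDiagram lam mu) s =
          Matrix.det (Matrix.of fun i j : Fin r =>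
            SchurSo.hashZeta N (SchurSo.skewDiagram lam mu) s fill dir (θ i) (θ j)) := by
  have hD := SchurSo.ordConnected_skewDiagram lam mu
  refine ⟨hθ.exists_isApproachRule hD, fun dir hdir fill => ?_⟩
  have hdet := (hθ.toStripLabelling hdir).soZeta_eq_det (N := N) hD
    (SchurSo.diagEntry (SchurSo.skewDiagram lam mu) s fill)
  simp only [SchurSo.diagEntry_content hs fill] at hdet
  simp only [SchurSo.hashZeta_eq_total]
  exact hdet
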